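/- Let $k$ be a field of characteristic zero. Let $\mathfrak g_F$ be the free post-Lie algebra on one generator over $k$, i.e. the free Lie algebra over the set of planar rooted trees with left grafting $\triangleright$, and let $\mathcal U(\mathfrak g_F)$ be its enveloping algebra (the free associative algebra on planar rooted trees, with basis the ordered forests), with concatenation, the coshuffle coproduct $\Delta$ (trees are primitive), counit $\epsilon$, the extension of $\triangleright$ determined by $$1\triangleright A=A,\qquad A\triangleright 1=\epsilon(A),\qquad xA\triangleright y=x\triangleright(A\triangleright y)-(x\triangleright A)\triangleright y\ \ (x,y\in\mathfrak g_F),\qquad A\triangleright BC=(A_{(1)}\triangleright B)(A_{(2)}\triangleright C),$$ and the Grossman--Larson product $A*B=A_{(1)}(A_{(2)}\triangleright B)$. All of this is extended to the completion $\mathcal U(\mathfrak g_F)^*$ with respect to the number of nodes (formal infinite linear combinations of ordered forests). Let $\mathfrak c_F\subset\mathcal U(\mathfrak g_F)^*$ be the infinitesimal characters ($\Delta\alpha=1\otimes\alpha+\alpha\otimes1$) and $\mathcal C_F$ the characters ($\Delta\alpha=\alpha\otimes\alpha$, $\epsilon(\alpha)=1$). For $f\in\mathfrak c_F$ put $\exp^*(f)=\sum_{n\ge0}\frac1{n!}f^{*n}$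 and $\exp(f)=\sum_{n\ge0}\frac1{n!}f^{n}$ (concatenation powers). For $\theta,\eta\in\mathfrak c_F$ put $[\theta,\eta]=\theta\eta-\eta\theta$, $\operatorname{ad}_\theta\eta=[\theta,\eta]$ and $$d\exp^{-1}_\theta(\eta)=\sum_{n\ge0}\frac{B_n}{n!}\operatorname{ad}_\theta^{\,n}(\eta)=\eta+\tfrac12[\theta,\eta]+\tfrac1{12}[\theta,[\theta,\eta]]+\cdots,$$ where $B_n$ are the Bernoulli numbers with $B_1=+\frac12$. Then: 1. $\exp^*$ and $\exp$ map $\mathfrak c_F$ into $\mathcal C_F$. 2. For every $\theta\in\mathfrak c_F$, $d\exp^{-1}_\theta$ is a bijection of $\mathfrak c_F$ onto itself, inverse to the left trivialized differential of $\exp$: for $\eta,\zeta\in\mathfrak c_F$ one has $\frac{d}{ds}\big|_{s=0}\exp(\theta+s\eta)=\exp(\theta)\,\zeta$ if and only if $\eta=d\exp_\theta^{-1}(\zeta)$. 3. For every $f\in\mathfrak c_F$ the initial value problem $$\theta'(t)=d\exp^{-1}_{\theta(t)}\big(\exp(\theta(t))\triangleright f\big),\qquad\theta(0)=0,$$ has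 a solution $\theta(t)\in\mathfrak c_F$, and for every such solution $\exp^*(f)=\exp(\theta(1))$. In 2 and 3, differentiation over $k$ is formal: every coefficient of the curve is a polynomial in the time parameter in $k$ and is differentiated as such. If $k=\mathbb R$ or $k=\mathbb C$, then 3 also holds with real time and the usual derivative of each coefficient: a solution exists for $t\in\mathbb R$, and $\exp^*(f)=\exp(\theta(1))$ holds for every solution that is differentiable on $[0,1]$. -/

import Mathlib

open scoped Nat

namespace LieButcher

/-- Planar (ordered) rooted trees: a root together with the ordered list of its branches. -/
inductive PlanarTree : Type
  | node : List PlanarTree → PlanarTree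

/-- Ordered forests, i.e. words in the alphabet of planar rooted trees. They form the basis of the
enveloping algebra `U(g_F)` of the free Lie algebra `g_F` over planar rooted trees (which is the
free associative algebra on the trees). The empty word `[]` is the unit. -/
abbrev Forest : Type := List PlanarTree

open PlanarTree

/-- The grading: the number of nodes of a forest. -/
def nodes : Forest → ℕ
  | [] => 0
  | node c :: ν => nodes c + 1 + nodes ν

/-- The coshuffle coproduct of a word: the multiset (formal sum with multiplicities) of all pairs
(subword, complementary subword). It is multiplicative with `Δ x = x ⊗ 1 + 1 ⊗ x` on letters. -/
def coshuffle : Forest → Multiset (Forest × Forest)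
  | [] => {([], [])}
  | x :: μ => (coshuffle μ).map (fun p => (x :: p.1, p.2)) +
      (coshuffle μ).map (fun p => (p.1, x :: p.2))

/-- Left grafting `μ ▷ ν` of words, a sum of words: `μ ▷ 1 = ε(μ)`,
`μ ▷ (τ ν) = (μ₁ ▷ τ) (μ₂ ▷ ν)` for a tree `τ` (with `Δ μ = μ₁ ⊗ μ₂`), and in `μ ▷ B⁺(c)` the
letters of `μ` are attached, to the left of what is already there, either to the root or to the
nodes of `c`. See `graft_nil_left`, `graft_cons_add`, `graft_append`, `graft_tree` for the
characterization of `▷` as the extension to `U(g_F)` of left grafting of trees. -/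
def graft : Forest → Forest → Multiset Forest
  | μ, [] => if μ = [] then {[]} else 0
  | μ, node c :: ν =>
      (coshuffle μ).bind fun p =>
        ((coshuffle p.1).bind fun q => (graft q.2 c).map fun d => q.1 ++ d).bind fun e =>
          (graft p.2 ν).map fun v => node e :: v
  termination_by _ ν => sizeOf ν

/-- Grossman--Larson product of words, `μ * ν = μ₁ (μ₂ ▷ ν)`. -/
def grossmanLarson (μ ν : Forest) : Multiset Forest :=
  (coshuffle μ).bind fun q => (graft q.2 ν).map fun d => q.1 ++ d


theorem graft_nil_right (μ : Forest) : graft μ [] = if μ = [] then {[]} else 0 := by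
  rw [graft]

theorem graft_node_cons (μ c ν : Forest) :
    graft μ (node c :: ν) = (coshuffle μ).bind fun p => (grossmanLarson p.1 c).bind fun e =>
      (graft p.2 ν).map fun v => node e :: v := by
  rw [graft]; rfl

theorem nodes_append (μ ν : Forest) : nodes (μ ++ ν) = nodes μ + nodes ν := by
  induction μ with
  | nil => simp [nodes]
  | cons x μ ih => cases x; simp only [List.cons_append, nodes, ih]; omega

theorem nodes_coshuffle {μ : Forest} {p : Forest × Forest} (h : p ∈ coshuffle μ) :
    nodes p.1 + nodes p.2 = nodes μ := by
  induction μ generalizing p with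
  | nil => simp [coshuffle] at h; simp [h, nodes]
  | cons x μ ih =>
    cases x
    simp only [coshuffle, Multiset.mem_add, Multiset.mem_map] at h
    rcases h with ⟨q, hq, rfl⟩ | ⟨q, hq, rfl⟩ <;> simp only [nodes] <;> have := ih hq <;> omega

theorem nodes_graft {μ ν ω : Forest} (h : ω ∈ graft μ ν) : nodes ω = nodes μ + nodes ν := by
  induction ν using nodes.induct generalizing μ ω with
  | case1 => 
    rw [graft_nil_right] at h
    split_ifs at h with h1 <;> simp_all [nodes]
  | case2 c ν ih1 ih2 =>
    simp only [graft_node_cons, grossmanLarson, Multiset.mem_bind, Multiset.mem_map] at h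
    obtain ⟨p, hp, _, ⟨q, hq, d, hd, rfl⟩, v, hv, rfl⟩ := h
    have := nodes_coshuffle hp
    have := nodes_coshuffle hq
    have := ih1 hd
    have := ih2 hv
    simp only [nodes, nodes_append]
    omega

theorem nodes_grossmanLarson {μ ν ω : Forest} (h : ω ∈ grossmanLarson μ ν) :
    nodes ω = nodes μ + nodes ν := by
  simp only [grossmanLarson, Multiset.mem_bind, Multiset.mem_map] at h
  obtain ⟨q, hq, d, hd, rfl⟩ := h
  have := nodes_coshuffle hq
  have := nodes_graft hd
  rw [nodes_append]; omega

theorem finite_nodes_le (n : ℕ) : {μ : Forest | nodes μ ≤ n}.Finite := by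
  induction n with
  | zero =>
    refine (Set.finite_singleton []).subset fun μ h => ?_
    rcases μ with _ | ⟨⟨c⟩, ν⟩ <;> simp_all [nodes]
  | succ n ih =>
    refine ((ih.image2 (fun c ν => node c :: ν) ih).union (Set.finite_singleton [])).subset
      fun μ h => ?_
    rcases μ with _ | ⟨⟨c⟩, ν⟩
    · simp
    · simp only [nodes, Set.mem_ofPred_eq] at h
      exact Or.inl ⟨c, by simp; omega, ν, by simp; omega, rfl⟩

theorem graft_nil_left (ν : Forest) : graft [] ν = {ν} := by
  induction ν using nodes.induct with
  | case1 => simp [graft_nil_right]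
  | case2 c ν ih1 ih2 => simp [graft_node_cons, grossmanLarson, coshuffle, ih1, ih2]

theorem coshuffle_coassoc {β : Type*} (μ : Forest)
    (F : Forest → Forest → Forest → Multiset β) :
    ((coshuffle μ).bind fun p => (coshuffle p.1).bind fun q => F q.1 q.2 p.2) =
      (coshuffle μ).bind fun p => (coshuffle p.2).bind fun q => F p.1 q.1 q.2 := by
  induction μ generalizing F with
  | nil => simp [coshuffle]
  | cons x μ ih =>
    simp only [coshuffle, Multiset.add_bind, Multiset.bind_map, Multiset.bind_add]
    rw [ih (fun a b c => F (x :: a) b c), ih (fun a b c => F a (x :: b) c),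
      ih (fun a b c => F a b (x :: c))]
    rw [add_assoc]

theorem coshuffle_counit_left {β : Type*} (μ : Forest) (F : Forest → Multiset β) :
    ((coshuffle μ).bind fun p => if p.1 = [] then F p.2 else 0) = F μ := by
  induction μ generalizing F with
  | nil => simp [coshuffle]
  | cons x μ ih =>
    simp only [coshuffle, Multiset.add_bind, Multiset.bind_map]
    simpa using ih fun a => F (x :: a)

/-- `A ▷ BC = (A₁ ▷ B) (A₂ ▷ C)`. -/
theorem graft_append (μ ν ρ : Forest) :
    graft μ (ν ++ ρ) = (coshuffle μ).bind fun p =>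
      (graft p.1 ν).bind fun a => (graft p.2 ρ).map fun b => a ++ b := by
  induction ν generalizing μ with
  | nil =>
    simp only [List.nil_append, graft_nil_right]
    conv_lhs => rw [← coshuffle_counit_left μ fun a => graft a ρ]
    refine Multiset.bind_congr fun p _ => ?_
    split_ifs <;> simp
  | cons x ν ih =>
    obtain ⟨c⟩ := x
    simp only [List.cons_append, graft_node_cons, ih]
    simp only [Multiset.map_bind, Multiset.bind_assoc, Multiset.bind_map, Multiset.map_map,
      Function.comp_def]
    rw [coshuffle_coassoc μ fun a b d => (grossmanLarson a c).bind fun e =>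
      (graft b ν).bind fun v => (graft d ρ).map fun w => node e :: v ++ w]
    refine Multiset.bind_congr fun p _ => ?_
    rw [Multiset.bind_bind]
    rfl

/-- Grafting one tree on one tree: attach it, from the left, to the root or to another node. -/
theorem graft_tree (x : PlanarTree) (c : Forest) :
    graft [x] [node c] = {[node (x :: c)]} + (graft [x] c).map fun d => [node d] := by
  simp [graft_node_cons, graft_nil_right, grossmanLarson, coshuffle, graft_nil_left]

/-- A single tree acts by derivations. -/
theorem graft_single_append (x : PlanarTree) (ν ρ : Forest) :
    graft [x] (ν ++ ρ) = ((graft [x] ν).map fun a => a ++ ρ) + (graft [x] ρ).map fun b => ν ++ b := by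
  rw [graft_append]
  simp [coshuffle, graft_nil_left, Multiset.bind_singleton]

theorem graft_single_cons (x y : PlanarTree) (ν : Forest) :
    graft [x] (y :: ν) = ((graft [x] [y]).map fun a => a ++ ν) +
      (graft [x] ν).map fun b => y :: b :=
  graft_single_append x [y] ν

/-- `Δ (x ▷ A) = (x ▷ A₁) ⊗ A₂ + A₁ ⊗ (x ▷ A₂)`. -/
theorem coshuffle_graft_single {β : Type*} (x : PlanarTree) (μ : Forest)
    (F : Forest → Forest → Multiset β) :
    ((graft [x] μ).bind fun a => (coshuffle a).bind fun p => F p.1 p.2) =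
      (coshuffle μ).bind fun p => ((graft [x] p.1).bind fun a => F a p.2) +
        (graft [x] p.2).bind fun a => F p.1 a := by
  induction μ generalizing F with
  | nil => simp [coshuffle, graft_nil_right]
  | cons y μ ih =>
    obtain ⟨c⟩ := y
    have e1 := ih fun a b => F (node c :: a) b
    have e2 := ih fun a b => F a (node c :: b)
    have hc : ∀ a : Forest, graft [x] (node c :: a) = {node (x :: c) :: a} +
        ((graft [x] c).map fun d => node d :: a) + (graft [x] a).map fun b => node c :: b := by
      intro a
      rw [graft_single_cons, graft_tree]
      simp
    simp only [coshuffle, Multiset.add_bind, Multiset.bind_map, hc, Multiset.bind_add,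
      Multiset.singleton_bind] at e1 e2 ⊢
    rw [e1, e2, Multiset.bind_bind (graft [x] c), Multiset.bind_bind (graft [x] c)]
    abel

/-- `x ▷ (A ▷ B) = xA ▷ B + (x ▷ A) ▷ B`. -/
theorem graft_cons_add (x : PlanarTree) (μ ν : Forest) :
    graft (x :: μ) ν + ((graft [x] μ).bind fun a => graft a ν) =
      (graft μ ν).bind fun b => graft [x] b := by
  induction ν using nodes.induct generalizing μ with
  | case1 => 
    rcases μ with _ | ⟨⟨c⟩, μ⟩
    · simp [graft_nil_right]
    · have : ∀ a ∈ graft [x] (node c :: μ), a ≠ [] := by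
        rintro a h rfl
        have := nodes_graft h
        simp only [nodes] at this
        obtain ⟨d⟩ := x
        simp only [nodes] at this
        omega
      simp only [graft_nil_right]
      simp
      rw [Multiset.bind_congr (g := fun _ => 0) (fun a ha => by simp [this a ha])]
      simp
  | case2 c ν ih1 ih2 => 
    have key : ∀ A : Forest, (grossmanLarson (x :: A) c) +
        ((graft [x] A).bind fun a => grossmanLarson a c) =
        ((grossmanLarson A c).map fun e => x :: e) + (grossmanLarson A c).bind fun e => graft [x] e := by
      intro A
      simp only [grossmanLarson]
      rw [coshuffle_graft_single x A fun a b => (graft b c).map fun d => a ++ d]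
      simp only [coshuffle, Multiset.add_bind, Multiset.bind_map, Multiset.bind_add,
        Multiset.map_bind, Multiset.bind_assoc, Multiset.map_map, Function.comp_def,
        graft_single_append]
      have : ∀ p : Forest × Forest, ((graft p.2 c).bind fun d => (graft [x] d).map fun b => p.1 ++ b)
         = ((graft (x :: p.2) c).map fun d => p.1 ++ d) + 
          (graft [x] p.2).bind fun a => (graft a c).map fun d => p.1 ++ d := by
        intro p
        rw [← Multiset.map_bind, ← ih1, Multiset.map_add, Multiset.map_bind]
      simp only [this, Multiset.bind_add]
      have h2 : ∀ p : Forest × Forest, ((graft p.2 c).bind fun d => (graft [x] p.1).map fun b => b ++ d)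
         = (graft [x] p.1).bind fun a => (graft p.2 c).map fun d => a ++ d := fun p =>
         Multiset.bind_map_comm _ _
      simp only [h2, List.cons_append]
      abel
    have hx : ∀ e v : Forest, graft [x] (node e :: v) = {node (x :: e) :: v} +
        ((graft [x] e).map fun d => node d :: v) + (graft [x] v).map fun b => node e :: b := by
      intro e v
      rw [graft_single_cons, graft_tree]
      simp
    simp only [graft_node_cons]
    rw [coshuffle_graft_single x μ fun a b => (grossmanLarson a c).bind fun e =>
      (graft b ν).map fun v => node e :: v]
    simp only [coshuffle, Multiset.add_bind, Multiset.bind_map, Multiset.bind_assoc, hx,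
      Multiset.bind_add, Multiset.bind_singleton]
    simp only [← Multiset.bind_add]
    refine Multiset.bind_congr fun p _ => ?_
    have k1 := congrArg (fun M => M.bind fun e => (graft p.2 ν).map fun v => node e :: v) (key p.1)
    have k2 := congrArg (fun M => (grossmanLarson p.1 c).bind fun e => M.map fun v => node e :: v)
      (ih2 p.2)
    simp only [Multiset.add_bind, Multiset.bind_map, Multiset.bind_assoc, Multiset.map_add,
      Multiset.bind_add, Multiset.map_bind] at k1 k2
    have k3 : ((graft [x] p.2).bind fun a => (grossmanLarson p.1 c).bind fun e =>
        (graft a ν).map fun v => node e :: v) = (grossmanLarson p.1 c).bind fun e =>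
        (graft [x] p.2).bind fun a => (graft a ν).map fun v => node e :: v :=
      Multiset.bind_bind _ _
    have k4 : ∀ e : Forest, ((graft p.2 ν).bind fun v => (graft [x] e).map fun d => node d :: v) =
        (graft [x] e).bind fun d => (graft p.2 ν).map fun v => node d :: v := fun e =>
      Multiset.bind_map_comm _ _
    simp only [k3, k4, Multiset.bind_add, ← k2]
    have k5 := congrArg (fun M => M + ((grossmanLarson p.1 c).bind fun a =>
      (graft (x :: p.2) ν).map fun v => node a :: v) + (grossmanLarson p.1 c).bind fun a =>
        (graft [x] p.2).bind fun b => (graft b ν).map fun v => node a :: v) k1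
    simp only [← add_assoc] at k5 ⊢
    rw [← k5]
    abel

/-! ### Lie--Butcher series: the graded completion of `U(g_F)` -/

/-- The graded completion `U(g_F)^*`: all formal infinite sums `∑ α(ω) ω` of ordered forests with
coefficients in `k`, given by the coefficients `α(ω) = ⟨α, ω⟩`. -/
abbrev LBSeries (k : Type*) : Type _ := Forest → k

noncomputable instance : DecidableEq PlanarTree := Classical.decEq _

section Series

variable {k : Type*} [Field k]

/-- The unit series, i.e. the empty word. -/
noncomputable def one : LBSeries k := Pi.single [] 1

/-- Extension of a product of words to series,
`(∑ α(μ) μ) · (∑ β(ν) ν) = ∑ α(μ) β(ν) μ · ν`. If the product respects the number of nodes, as the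
three products below do, then each coefficient is a finite sum (`finite_support_extend`). -/
noncomputable def extend (op : Forest → Forest → Multiset Forest) (α β : LBSeries k) :
    LBSeries k :=
  fun ω => ∑ᶠ p : Forest × Forest, α p.1 * β p.2 * ((op p.1 p.2).count ω : k)

theorem finite_support_extend {op : Forest → Forest → Multiset Forest}
    (hop : ∀ μ ν, ∀ ω ∈ op μ ν, nodes ω = nodes μ + nodes ν) (α β : LBSeries k) (ω : Forest) :
    (Function.support fun p : Forest × Forest =>
      α p.1 * β p.2 * ((op p.1 p.2).count ω : k)).Finite := by
  refine ((finite_nodes_le (nodes ω)).prod (finite_nodes_le (nodes ω))).subset fun p hp => ?_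
  have h : ω ∈ op p.1 p.2 := by
    by_contra h
    exact hp (by simp [Multiset.count_eq_zero_of_notMem h])
  have := hop _ _ _ h
  exact ⟨by simp only [Set.mem_ofPred_eq]; omega, by simp only [Set.mem_ofPred_eq]; omega⟩

/-- The concatenation product of series, extending the product of `U(g_F)`. -/
noncomputable def concatMul (α β : LBSeries k) : LBSeries k :=
  extend (fun μ ν => {μ ++ ν}) α β

/-- The left grafting (post-Lie) product `α ▷ β` of series. -/
noncomputable def graftMul (α β : LBSeries k) : LBSeries k :=
  extend graft α β

/-- The Grossman--Larson product `α * β` of series. -/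
noncomputable def grossmanLarsonMul (α β : LBSeries k) : LBSeries k :=
  extend grossmanLarson α β

/-- Powers `α · α · ... · α` for a product of series. -/
noncomputable def power (mul : LBSeries k → LBSeries k → LBSeries k) (α : LBSeries k) :
    ℕ → LBSeries k
  | 0 => one
  | n + 1 => mul (power mul α n) α

/-- The exponential series `∑ αⁿ / n!` for a product of series. For `α` without constant term (in
particular for infinitesimal characters) each coefficient is a finite sum
(`power_extend_eq_zero`). -/
noncomputable def expSeries (mul : LBSeries k → LBSeries k → LBSeries k) (α : LBSeries k) :
    LBSeries k :=
  fun ω => ∑ᶠ n : ℕ, (n ! : k)⁻¹ * power mul α n ω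

theorem extend_eq_zero {op : Forest → Forest → Multiset Forest}
    (hop : ∀ μ ν, ∀ ω ∈ op μ ν, nodes ω = nodes μ + nodes ν) {α β : LBSeries k} {a b : ℕ}
    (hα : ∀ μ, nodes μ < a → α μ = 0) (hβ : ∀ μ, nodes μ < b → β μ = 0) {ω : Forest}
    (hω : nodes ω < a + b) : extend op α β ω = 0 := by
  refine finsum_eq_zero_of_forall_eq_zero fun p => ?_
  by_cases h : ω ∈ op p.1 p.2
  · have := hop _ _ _ h
    by_cases h1 : nodes p.1 < a
    · simp [hα _ h1]
    · simp [hβ p.2 (by omega)]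
  · simp [Multiset.count_eq_zero_of_notMem h]

theorem eq_zero_of_nodes_lt_one {α : LBSeries k} (h : α [] = 0) (μ : Forest)
    (hμ : nodes μ < 1) : α μ = 0 := by
  rcases μ with _ | ⟨⟨c⟩, ν⟩
  · exact h
  · simp only [nodes] at hμ; omega

theorem power_extend_eq_zero {op : Forest → Forest → Multiset Forest}
    (hop : ∀ μ ν, ∀ ω ∈ op μ ν, nodes ω = nodes μ + nodes ν) {α : LBSeries k} (hα : α [] = 0)
    (n : ℕ) (ω : Forest) (hω : nodes ω < n) : power (extend op) α n ω = 0 := by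
  induction n generalizing ω with
  | zero => omega
  | succ n ih => exact extend_eq_zero hop ih (eq_zero_of_nodes_lt_one hα) hω

/-- `exp`, the exponential for concatenation. -/
noncomputable def exp (α : LBSeries k) : LBSeries k := expSeries concatMul α

/-- `exp^*`, the exponential for the Grossman--Larson product. -/
noncomputable def expStar (α : LBSeries k) : LBSeries k := expSeries grossmanLarsonMul α

/-- The coshuffle coproduct of a series, as a formal infinite sum of the `μ ⊗ ν`, given by its
coefficients. They are finite sums (`finite_support_coproduct`). -/
noncomputable def coproduct (α : LBSeries k) : Forest × Forest → k :=
  fun q => ∑ᶠ ω : Forest, α ω * ((coshuffle ω).count q : k)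

theorem finite_support_coproduct (α : LBSeries k) (q : Forest × Forest) :
    (Function.support fun ω : Forest => α ω * ((coshuffle ω).count q : k)).Finite := by
  refine (finite_nodes_le (nodes q.1 + nodes q.2)).subset fun ω hω => ?_
  have h : q ∈ coshuffle ω := by
    by_contra h
    exact hω (by simp [Multiset.count_eq_zero_of_notMem h])
  exact (nodes_coshuffle h).ge

variable (k) in
/-- Infinitesimal characters (primitive series): `Δ α = 1 ⊗ α + α ⊗ 1`. -/
def infChars : Set (LBSeries k) :=
  {α | ∀ μ ν, coproduct α (μ, ν) = one μ * α ν + α μ * one ν}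

variable (k) in
/-- Characters (group-like series): `Δ α = α ⊗ α`, `ε(α) = 1`; the normalization only excludes
`α = 0`. -/
def chars : Set (LBSeries k) :=
  {α | (∀ μ ν, coproduct α (μ, ν) = α μ * α ν) ∧ α [] = 1}

/-- The Lie bracket `[α, β]` of `g_F`, extended to series: the commutator for concatenation. -/
noncomputable def bracket (α β : LBSeries k) : LBSeries k := concatMul α β - concatMul β α

/-- `dexp⁻¹_θ(η) = ∑ₙ Bₙ / n! ad_θⁿ(η) = η + 1/2 [θ, η] + 1/12 [θ, [θ, η]] + ...`; here
`bernoulli'` are the Bernoulli numbers with `B₁ = +1/2`. For `θ` without constant term each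
coefficient is a finite sum (`iterate_bracket_eq_zero`). -/
noncomputable def dexpInv (θ η : LBSeries k) : LBSeries k :=
  fun ω => ∑ᶠ n : ℕ, ((bernoulli' n / (n ! : ℚ) : ℚ) : k) * (bracket θ)^[n] η ω

theorem nodes_concat (μ ν : Forest) :
    ∀ ω ∈ ({μ ++ ν} : Multiset Forest), nodes ω = nodes μ + nodes ν := by
  intro ω h
  rw [Multiset.mem_singleton.1 h, nodes_append]

theorem iterate_bracket_eq_zero {θ : LBSeries k} (hθ : θ [] = 0) (η : LBSeries k) (n : ℕ)
    (ω : Forest) (hω : nodes ω < n) : (bracket θ)^[n] η ω = 0 := by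
  induction n generalizing ω with
  | zero => omega
  | succ n ih =>
    rw [Function.iterate_succ_apply']
    have h1 := extend_eq_zero nodes_concat (eq_zero_of_nodes_lt_one hθ) ih (ω := ω) (by omega)
    have h2 := extend_eq_zero nodes_concat ih (eq_zero_of_nodes_lt_one hθ) (ω := ω) (by omega)
    simp [bracket, concatMul, h1, h2]

/-- `γ` is a curve of series, with polynomial coefficients in the time `s ∈ k`, whose formal
coefficientwise derivative at time `t` is `v`. -/
def HasFormalDerivAt (γ : k → LBSeries k) (v : LBSeries k) (t : k) : Prop :=
  ∃ p : Forest → Polynomial k,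
    (∀ s ω, γ s ω = (p ω).eval s) ∧ ∀ ω, v ω = (Polynomial.derivative (p ω)).eval t

/-- `ζ = dexp_θ(η)`, the left trivialized differential of `exp`:
`d/ds exp(θ + s η) = exp(θ) ζ` at `s = 0`. -/
def IsLeftTrivializedDifferential (θ η ζ : LBSeries k) : Prop :=
  HasFormalDerivAt (fun s : k => exp (θ + s • η)) (concatMul (exp θ) ζ) 0

/-- The right-hand side `dexp⁻¹_θ(exp(θ) ▷ f)` of the differential equation. -/
noncomputable def exponentField (f θ : LBSeries k) : LBSeries k :=
  dexpInv θ (graftMul (exp θ) f)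

/-- `θ` is a curve of infinitesimal characters, with polynomial coefficients in the time `t ∈ k`,
which solves `θ' = dexp⁻¹_θ(exp(θ) ▷ f)`, `θ(0) = 0` (formal derivative). -/
def IsFormalSolution (f : LBSeries k) (θ : k → LBSeries k) : Prop :=
  θ 0 = 0 ∧ ∀ t, θ t ∈ infChars k ∧ HasFormalDerivAt θ (exponentField f (θ t)) t

end Series

/-- Over the real or complex numbers: `θ` is a curve of infinitesimal characters which solves
`θ' = dexp⁻¹_θ(exp(θ) ▷ f)`, `θ(0) = 0` for real times in `S`; the derivative is the usual one of
each coefficient. -/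
def IsRealTimeSolutionOn {𝕜 : Type*} [RCLike 𝕜] (S : Set ℝ) (f : LBSeries 𝕜)
    (θ : ℝ → LBSeries 𝕜) : Prop :=
  θ 0 = 0 ∧ ∀ t ∈ S, θ t ∈ infChars 𝕜 ∧
    ∀ ω, HasDerivWithinAt (fun s => θ s ω) (exponentField f (θ t) ω) S t

end LieButcher

/-! Both `y(t) = exp(θ(t))` and `z(t) = exp^*(t f)` solve the linear equation `y' = y * f`, `y(0) =
1`. For `z` this is termwise differentiation. For `y` one has `d/dt exp(θ) = exp(θ) dexp_θ(θ')`
(`TimeDerivative.HasDS.exp`), so the differential equation for `θ` says `y' = y · (y ▷ f)`; since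
`y` is group-like, this is `y * f` (`grossmanLarsonMul_of_mem_chars`). As `f` has no constant term,
the equation is triangular in the number of nodes, which gives uniqueness
(`TimeDerivative.eq_of_hasDS_grossmanLarsonMul`) and hence `y = z`.

Group-likeness of both exponentials: concatenation and the Grossman–Larson product are morphisms of
coalgebras, so for primitive `α` the coproduct of `αⁿ` is given by the binomial theorem
(`coproduct_power`).

The differential of `exp` comes from moving all factors `θ` in the derivative of `θⁿ` to the left
(`powerDeriv_succ`). The result is the series `(1 - e⁻ᶻ) / z` in `ad_θ`. Series in `ad_θ` multiply
like power series (`adSeries_mul`), so the inverse is given by `z / (1 - e⁻ᶻ)`, the Bernoulli series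
with `B₁ = +1/2`.

For existence, take `θ(t) = log(exp^*(t f))`, with the logarithm built degree by degree, and read
the computation backwards. The argument for uniqueness uses only a few rules for derivatives,
collected in `TimeDerivative`, and so covers formal and real time together. -/

namespace LieButcher
open PlanarTree

/-! ### Products of words and the coshuffle coproduct -/

theorem coshuffle_comm {β : Type*} (μ : Forest) (F : Forest → Forest → Multiset β) :
    ((coshuffle μ).bind fun p => F p.1 p.2) = (coshuffle μ).bind fun p => F p.2 p.1 := by
  induction μ generalizing F with
  | nil => simp [coshuffle]
  | cons x μ ih =>
    simp only [coshuffle, Multiset.add_bind, Multiset.bind_map]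
    rw [ih fun a b => F (x :: a) b, ih fun a b => F a (x :: b), add_comm]

theorem coshuffle_counit_right {β : Type*} (μ : Forest) (F : Forest → Multiset β) :
    ((coshuffle μ).bind fun p => if p.2 = [] then F p.1 else 0) = F μ := by
  rw [coshuffle_comm μ fun a b => if b = [] then F a else 0]
  exact coshuffle_counit_left μ F

theorem coshuffle_left_comm {β : Type*} (μ : Forest)
    (F : Forest → Forest → Forest → Multiset β) :
    ((coshuffle μ).bind fun p => (coshuffle p.2).bind fun q => F p.1 q.1 q.2) =
      (coshuffle μ).bind fun p => (coshuffle p.2).bind fun q => F q.1 p.1 q.2 := by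
  rw [← coshuffle_coassoc, ← coshuffle_coassoc μ fun a b c => F b a c]
  exact Multiset.bind_congr fun p _ => coshuffle_comm p.1 fun a b => F a b p.2

theorem coshuffle_middle_comm {β : Type*} (μ : Forest)
    (F : Forest → Forest → Forest → Forest → Multiset β) :
    ((coshuffle μ).bind fun p => (coshuffle p.1).bind fun q => (coshuffle p.2).bind fun r =>
        F q.1 q.2 r.1 r.2) =
      (coshuffle μ).bind fun p => (coshuffle p.1).bind fun q => (coshuffle p.2).bind fun r =>
        F q.1 r.1 q.2 r.2 := by
  rw [coshuffle_coassoc μ fun a b c => (coshuffle c).bind fun r => F a b r.1 r.2,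
    coshuffle_coassoc μ fun a b c => (coshuffle c).bind fun r => F a r.1 b r.2]
  exact Multiset.bind_congr fun p _ => coshuffle_left_comm p.2 fun a b c => F p.1 a b c

theorem coshuffle_append {β : Type*} (μ ν : Forest) (F : Forest → Forest → Multiset β) :
    ((coshuffle (μ ++ ν)).bind fun p => F p.1 p.2) =
      (coshuffle μ).bind fun p => (coshuffle ν).bind fun q => F (p.1 ++ q.1) (p.2 ++ q.2) := by
  induction μ generalizing F with
  | nil => simp [coshuffle]
  | cons x μ ih =>
    simp only [List.cons_append, coshuffle, Multiset.add_bind, Multiset.bind_map]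
    rw [ih fun a b => F (x :: a) b, ih fun a b => F a (x :: b)]

/-- By induction on the trees of `ν`. The first tree absorbs its share of `μ` whole and then lies in
one of the two tensor factors; only the share that acts on the other trees is split. If it lies in
the left factor, coassociativity matches the two sides; in the right factor cocommutativity is
needed as well. -/
theorem coshuffle_graft {β : Type*} (μ ν : Forest) (F : Forest → Forest → Multiset β) :
    ((graft μ ν).bind fun a => (coshuffle a).bind fun p => F p.1 p.2) =
      (coshuffle μ).bind fun p => (coshuffle ν).bind fun q =>
        (graft p.1 q.1).bind fun a => (graft p.2 q.2).bind fun b => F a b := by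
  induction ν generalizing μ F with
  | nil =>
    simp only [coshuffle, Multiset.singleton_bind, graft_nil_right]
    have := coshuffle_counit_left μ fun a =>
      (if a = [] then {[]} else 0 : Multiset Forest).bind fun b => F [] b
    rw [show ((coshuffle μ).bind fun p => (if p.1 = [] then {[]} else 0 : Multiset Forest).bind
        fun a => (if p.2 = [] then {[]} else 0 : Multiset Forest).bind fun b => F a b) = _ from
      (Multiset.bind_congr fun p _ => by split_ifs <;> simp).trans this]
    split_ifs <;> simp [coshuffle]
  | cons x ν ih =>
    obtain ⟨c⟩ := x
    simp only [graft_node_cons, coshuffle, Multiset.bind_assoc, Multiset.bind_map,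
      Multiset.add_bind, Multiset.bind_add]
    have h1 := fun e μ => ih μ fun a b => F (node e :: a) b
    have h2 := fun e μ => ih μ fun a b => F a (node e :: b)
    simp only [h1, h2]
    congr 1
    · rw [← Multiset.bind_congr fun p _ =>
        Multiset.bind_bind (coshuffle p.2) (grossmanLarson p.1 c)]
      rw [← coshuffle_coassoc μ fun a b d => (grossmanLarson a c).bind fun e =>
        (coshuffle ν).bind fun q => (graft b q.1).bind fun a => (graft d q.2).bind fun b =>
          F (node e :: a) b]
      refine Multiset.bind_congr fun p _ => ?_
      rw [Multiset.bind_bind (coshuffle ν)]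
      refine Multiset.bind_congr fun q _ => ?_
      rw [Multiset.bind_bind (coshuffle ν)]
    · rw [← Multiset.bind_congr fun p _ =>
        Multiset.bind_bind (coshuffle p.2) (grossmanLarson p.1 c)]
      rw [coshuffle_left_comm μ fun a b d => (grossmanLarson a c).bind fun e =>
        (coshuffle ν).bind fun q => (graft b q.1).bind fun a => (graft d q.2).bind fun b =>
          F a (node e :: b)]
      refine Multiset.bind_congr fun p _ => ?_
      simp only [Multiset.bind_bind (graft p.1 _) (coshuffle p.2),
        Multiset.bind_bind (graft p.1 _) (grossmanLarson _ c)]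
      rw [Multiset.bind_bind (coshuffle ν)]
      refine Multiset.bind_congr fun q _ => ?_
      rw [Multiset.bind_bind (coshuffle ν)]

/-- Both ingredients of `μ₁ (μ₂ ▷ ν)` respect the coproduct. What remains is to exchange the two
middle factors of the fourfold coproduct of `μ`, which is cocommutativity. -/
theorem coshuffle_grossmanLarson {β : Type*} (μ ν : Forest) (F : Forest → Forest → Multiset β) :
    ((grossmanLarson μ ν).bind fun a => (coshuffle a).bind fun p => F p.1 p.2) =
      (coshuffle μ).bind fun p => (coshuffle ν).bind fun q =>
        (grossmanLarson p.1 q.1).bind fun a => (grossmanLarson p.2 q.2).bind fun b => F a b := by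
  simp only [grossmanLarson, Multiset.bind_assoc, Multiset.bind_map, coshuffle_append]
  simp only [Multiset.bind_bind (graft _ _) (coshuffle _)]
  have h := fun c d μ => coshuffle_graft μ ν fun a b => F (c ++ a) (d ++ b)
  simp only [h]
  rw [coshuffle_middle_comm μ fun a b d e => (coshuffle ν).bind fun q =>
    (graft d q.1).bind fun u => (graft e q.2).bind fun v => F (a ++ u) (b ++ v)]
  refine Multiset.bind_congr fun p _ => ?_
  simp only [Multiset.bind_bind (coshuffle _) (coshuffle ν)]

theorem grossmanLarson_nil_right (μ : Forest) : grossmanLarson μ [] = {μ} := by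
  simp only [grossmanLarson, graft_nil_right]
  rw [← coshuffle_counit_right μ fun a => {a}]
  refine Multiset.bind_congr fun p _ => ?_
  split_ifs <;> simp

/-! ### Series: finite sums and bilinearity -/

/-- A product of words that respects the number of nodes. -/
def Graded (op : Forest → Forest → Multiset Forest) : Prop :=
  ∀ μ ν, ∀ ω ∈ op μ ν, nodes ω = nodes μ + nodes ν

theorem graded_concat : Graded fun μ ν => {μ ++ ν} := nodes_concat

theorem graded_graft : Graded graft := fun _ _ _ => nodes_graft

theorem graded_grossmanLarson : Graded grossmanLarson := fun _ _ _ => nodes_grossmanLarson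

/-- The words with at most `N` nodes. -/
noncomputable def wordsLE (N : ℕ) : Finset Forest := (finite_nodes_le N).toFinset

theorem mem_wordsLE {N : ℕ} {μ : Forest} : μ ∈ wordsLE N ↔ nodes μ ≤ N := by
  simp [wordsLE]

theorem count_bind_eq_sum {α β : Type*} [DecidableEq α] [DecidableEq β] (s : Multiset α)
    (F : α → Multiset β) (b : β) (A : Finset α) (hA : ∀ a ∈ s, a ∈ A) :
    (s.bind F).count b = ∑ a ∈ A, s.count a * (F a).count b := by
  rw [Multiset.count_bind, Finset.sum_multiset_map_count]
  simp only [smul_eq_mul]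
  refine Finset.sum_subset (fun a ha => hA a (Multiset.mem_toFinset.1 ha)) fun a _ ha => ?_
  rw [Multiset.count_eq_zero_of_notMem fun h => ha (Multiset.mem_toFinset.2 h), zero_mul]

section

variable {k : Type*} [Field k]

/-- The bound `N` may exceed `nodes ω`, so that several coefficients can be computed over the same
finite set of words. -/
theorem extend_eq_sum {op : Forest → Forest → Multiset Forest} (hop : Graded op)
    (α β : LBSeries k) {ω : Forest} {N : ℕ} (h : nodes ω ≤ N) :
    extend op α β ω = ∑ μ ∈ wordsLE N, ∑ ν ∈ wordsLE N, α μ * β ν * ((op μ ν).count ω : k) := by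
  rw [← Finset.sum_product', extend]
  refine finsum_eq_sum_of_support_subset _ fun p hp => ?_
  have h : ω ∈ op p.1 p.2 := by
    by_contra h
    exact hp (by simp [Multiset.count_eq_zero_of_notMem h])
  have := hop _ _ _ h
  simp only [Finset.coe_product, Set.mem_prod, Finset.mem_coe, mem_wordsLE]
  omega

theorem coproduct_eq_sum (α : LBSeries k) {q : Forest × Forest} {N : ℕ}
    (h : nodes q.1 + nodes q.2 ≤ N) :
    coproduct α q = ∑ ω ∈ wordsLE N, α ω * ((coshuffle ω).count q : k) := by
  refine finsum_eq_sum_of_support_subset _ fun ω hω => ?_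
  have hq : q ∈ coshuffle ω := by
    by_contra hq
    exact hω (by simp [Multiset.count_eq_zero_of_notMem hq])
  rw [Finset.mem_coe, mem_wordsLE, ← nodes_coshuffle hq]
  exact h

theorem extend_congr {op : Forest → Forest → Multiset Forest} (hop : Graded op)
    {α β α' β' : LBSeries k} {ω : Forest}
    (h : ∀ μ ν, nodes μ + nodes ν = nodes ω → α μ * β ν = α' μ * β' ν) :
    extend op α β ω = extend op α' β' ω := by
  refine finsum_congr fun p => ?_
  by_cases hp : ω ∈ op p.1 p.2
  · rw [h _ _ (hop _ _ _ hp).symm]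
  · simp [Multiset.count_eq_zero_of_notMem hp]

theorem coproduct_congr {α β : LBSeries k} {q : Forest × Forest}
    (h : ∀ ω, nodes ω = nodes q.1 + nodes q.2 → α ω = β ω) : coproduct α q = coproduct β q := by
  refine finsum_congr fun ω => ?_
  by_cases hq : q ∈ coshuffle ω
  · rw [h _ (nodes_coshuffle hq).symm]
  · simp [Multiset.count_eq_zero_of_notMem hq]

/-- The extension of a product of words to series, as a bilinear map. -/
noncomputable def extendLin {op : Forest → Forest → Multiset Forest} (hop : Graded op) :
    LBSeries k →ₗ[k] LBSeries k →ₗ[k] LBSeries k :=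
  LinearMap.mk₂ k (extend op)
    (fun α α' β => by
      ext ω
      simp only [Pi.add_apply, extend_eq_sum hop _ _ le_rfl, add_mul, Finset.sum_add_distrib])
    (fun c α β => by
      ext ω
      simp only [Pi.smul_apply, smul_eq_mul, extend_eq_sum hop _ _ le_rfl, Finset.mul_sum,
        mul_assoc])
    (fun α β β' => by
      ext ω
      simp only [Pi.add_apply, extend_eq_sum hop _ _ le_rfl, add_mul, mul_add,
        Finset.sum_add_distrib])
    (fun c α β => by
      ext ω
      simp only [Pi.smul_apply, smul_eq_mul, extend_eq_sum hop _ _ le_rfl, Finset.mul_sum,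
        mul_assoc, mul_left_comm c])

@[simp] theorem extendLin_apply {op : Forest → Forest → Multiset Forest} (hop : Graded op)
    (α β : LBSeries k) : extendLin hop α β = extend op α β := rfl

/-- The coproduct of series, as a linear map. -/
noncomputable def coproductLin : LBSeries k →ₗ[k] (Forest × Forest → k) where
  toFun := coproduct
  map_add' α β := by
    ext q
    simp only [Pi.add_apply, coproduct_eq_sum _ le_rfl, add_mul, Finset.sum_add_distrib]
  map_smul' c α := by
    ext q
    simp only [Pi.smul_apply, smul_eq_mul, coproduct_eq_sum _ le_rfl, Finset.mul_sum, mul_assoc,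
      RingHom.id_apply]

@[simp] theorem coproductLin_apply (α : LBSeries k) : coproductLin α = coproduct α := rfl

theorem extend_flip (op : Forest → Forest → Multiset Forest) (α β : LBSeries k) :
    extend (fun μ ν => op ν μ) β α = extend op α β := by
  ext ω
  rw [extend, extend, ← finsum_comp_equiv (Equiv.prodComm Forest Forest)]
  refine finsum_congr fun p => ?_
  simp [mul_comm (β _)]

/-- Transfers identities between multisets of words to identities between series: pairing `γ · δ`
with `G` is the same as pairing `γ` and `δ` with `G` applied to products of words. The bound on `G`
makes the truncation at `N` lossless. -/
theorem sum_extend_mul_count {op : Forest → Forest → Multiset Forest} (hop : Graded op)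
    {β : Type*} [DecidableEq β] (γ δ : LBSeries k) (G : Forest → Multiset β) (b : β) {N : ℕ}
    (hG : ∀ σ, b ∈ G σ → nodes σ ≤ N) :
    ∑ σ ∈ wordsLE N, extend op γ δ σ * ((G σ).count b : k) =
      ∑ μ ∈ wordsLE N, ∑ ν ∈ wordsLE N, γ μ * δ ν * (((op μ ν).bind G).count b : k) := by
  have h1 : ∀ μ ν, (((op μ ν).bind G).count b : k) =
      ∑ σ ∈ wordsLE N, ((op μ ν).count σ : k) * ((G σ).count b : k) := by
    intro μ ν
    by_cases hμ : nodes μ + nodes ν ≤ N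
    · rw [count_bind_eq_sum _ _ _ (wordsLE N) fun σ hσ => by
        rw [mem_wordsLE, hop _ _ _ hσ]; exact hμ]
      push_cast; rfl
    · rw [Multiset.count_eq_zero_of_notMem, Finset.sum_eq_zero, Nat.cast_zero]
      · intro σ hσ
        rw [Multiset.count_eq_zero_of_notMem, Nat.cast_zero, zero_mul]
        intro h2
        exact hμ (hop _ _ _ h2 ▸ mem_wordsLE.1 hσ)
      · intro h2
        obtain ⟨σ, h3, h4⟩ := Multiset.mem_bind.1 h2
        exact hμ (hop _ _ _ h3 ▸ hG _ h4)
  rw [Finset.sum_congr rfl fun σ hσ => by rw [extend_eq_sum hop _ _ (mem_wordsLE.1 hσ)]]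
  simp only [h1, Finset.mul_sum, Finset.sum_mul, mul_assoc]
  rw [Finset.sum_comm]
  exact Finset.sum_congr rfl fun μ _ => Finset.sum_comm

/-- The counterpart of `sum_extend_mul_count` for the coproduct. -/
theorem sum_coproduct_mul_count {β : Type*} [DecidableEq β] (α : LBSeries k)
    (G : Forest × Forest → Multiset β) (b : β) {N : ℕ}
    (hG : ∀ q, b ∈ G q → nodes q.1 + nodes q.2 ≤ N) :
    ∑ σ ∈ wordsLE N, α σ * (((coshuffle σ).bind G).count b : k) =
      ∑ μ ∈ wordsLE N, ∑ ν ∈ wordsLE N, coproduct α (μ, ν) * ((G (μ, ν)).count b : k) := by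
  rw [← Finset.sum_product']
  have h1 : ∀ q : Forest × Forest, coproduct α q * ((G q).count b : k) =
      ∑ σ ∈ wordsLE N, α σ * (((coshuffle σ).count q : k) * ((G q).count b : k)) := by
    intro q
    by_cases hq : b ∈ G q
    · simp only [coproduct_eq_sum α (hG q hq), Finset.sum_mul, mul_assoc]
    · simp [Multiset.count_eq_zero_of_notMem hq]
  rw [Finset.sum_congr rfl fun q _ => h1 q, Finset.sum_comm]
  refine Finset.sum_congr rfl fun σ hσ => ?_
  rw [← Finset.mul_sum, count_bind_eq_sum _ _ _ (wordsLE N ×ˢ wordsLE N) fun q hq => ?_]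
  · push_cast; rfl
  · have := nodes_coshuffle hq
    rw [mem_wordsLE] at hσ
    simp only [Finset.mem_product, mem_wordsLE]
    omega

theorem extend_extend_left {op op' : Forest → Forest → Multiset Forest} (hop : Graded op)
    (hop' : Graded op') (α β γ : LBSeries k) {ω : Forest} {N : ℕ} (h : nodes ω ≤ N) :
    extend op (extend op' α β) γ ω = ∑ μ ∈ wordsLE N, ∑ ν ∈ wordsLE N, ∑ ρ ∈ wordsLE N,
      α μ * β ν * γ ρ * (((op' μ ν).bind fun σ => op σ ρ).count ω : k) := by
  rw [extend_eq_sum hop _ _ h, Finset.sum_comm]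
  have h1 : ∀ ρ, ∑ σ ∈ wordsLE N, extend op' α β σ * γ ρ * ((op σ ρ).count ω : k) =
      ∑ μ ∈ wordsLE N, ∑ ν ∈ wordsLE N,
        α μ * β ν * γ ρ * (((op' μ ν).bind fun σ => op σ ρ).count ω : k) := by
    intro ρ
    have := congrArg (γ ρ * ·) (sum_extend_mul_count hop' α β (fun σ => op σ ρ) ω (N := N)
      fun σ hσ => by have := hop _ _ _ hσ; omega)
    simp only [Finset.mul_sum] at this
    simpa only [mul_comm, mul_assoc, mul_left_comm] using this
  rw [Finset.sum_congr rfl fun ρ _ => h1 ρ, Finset.sum_comm]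
  exact Finset.sum_congr rfl fun μ _ => Finset.sum_comm

theorem extend_extend_right {op op' : Forest → Forest → Multiset Forest} (hop : Graded op)
    (hop' : Graded op') (α β γ : LBSeries k) {ω : Forest} {N : ℕ} (h : nodes ω ≤ N) :
    extend op α (extend op' β γ) ω = ∑ μ ∈ wordsLE N, ∑ ν ∈ wordsLE N, ∑ ρ ∈ wordsLE N,
      α μ * β ν * γ ρ * (((op' ν ρ).bind fun σ => op μ σ).count ω : k) := by
  have hop1 : Graded fun μ ν => op ν μ := fun μ ν ω hω => by rw [hop _ _ _ hω, add_comm]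
  rw [← extend_flip, extend_extend_left hop1 hop' _ _ _ h,
    Finset.sum_congr rfl fun μ _ => Finset.sum_comm, Finset.sum_comm]
  simp only [mul_comm, mul_left_comm]

theorem extend_one_right {op : Forest → Forest → Multiset Forest} (hop : Graded op)
    (h : ∀ μ, op μ [] = {μ}) (α : LBSeries k) : extend op α one = α := by
  ext ω
  have h0 : ([] : Forest) ∈ wordsLE (nodes ω) := mem_wordsLE.2 (by simp [nodes])
  rw [extend_eq_sum hop _ _ le_rfl]
  simp [one, Pi.single_apply, h0, h, Multiset.count_singleton, mem_wordsLE]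

theorem extend_one_left {op : Forest → Forest → Multiset Forest} (hop : Graded op)
    (h : ∀ μ, op [] μ = {μ}) (α : LBSeries k) : extend op one α = α := by
  rw [← extend_flip]
  exact extend_one_right (fun μ ν ω hω => by rw [hop _ _ _ hω, add_comm]) h α

theorem concatMul_assoc (α β γ : LBSeries k) :
    concatMul (concatMul α β) γ = concatMul α (concatMul β γ) := by
  ext ω
  simp only [concatMul]
  rw [extend_extend_left graded_concat graded_concat _ _ _ le_rfl,
    extend_extend_right graded_concat graded_concat _ _ _ le_rfl]
  simp

theorem one_concatMul (α : LBSeries k) : concatMul one α = α :=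
  extend_one_left graded_concat (by simp) α

/-- Primitivity at `([], [])` reads `a = a + a`. -/
theorem infChars_nil {α : LBSeries k} [CharZero k] (hα : α ∈ infChars k) : α [] = 0 := by
  have h := hα [] []
  rw [coproduct_eq_sum α (N := 0) (by simp [nodes])] at h
  have h1 : wordsLE 0 = {[]} := by
    ext μ
    rw [mem_wordsLE, Finset.mem_singleton]
    rcases μ with _ | ⟨⟨c⟩, ν⟩ <;> simp [nodes]
  simp [h1, coshuffle, one] at h
  exact h

/-- For group-like `α` one has `α * β = α · (α ▷ β)`. -/
theorem grossmanLarsonMul_of_mem_chars {α : LBSeries k} (hα : α ∈ chars k) (β : LBSeries k) :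
    grossmanLarsonMul α β = concatMul α (graftMul α β) := by
  ext ω
  rw [concatMul, graftMul, extend_extend_right graded_concat graded_graft _ _ _ le_rfl,
    grossmanLarsonMul, extend_eq_sum graded_grossmanLarson _ _ le_rfl, Finset.sum_comm]
  conv_rhs => rw [Finset.sum_congr rfl fun μ _ => Finset.sum_comm, Finset.sum_comm]
  refine Finset.sum_congr rfl fun ρ _ => ?_
  -- The word product `* ρ` is a contraction of the coshuffle. Hence the left side only involves the
  -- coproduct of `α`, and group-likeness replaces it by `α ⊗ α`, whose two factors are the separate
  -- copies of `α` on the right.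
  have := congrArg (β ρ * ·) (sum_coproduct_mul_count α
    (fun q => (graft q.2 ρ).map fun d => q.1 ++ d) ω (N := nodes ω) fun q hq => by
      obtain ⟨d, hd, rfl⟩ := Multiset.mem_map.1 hq
      rw [nodes_append, nodes_graft hd]
      omega)
  simp only [Finset.mul_sum, hα.1] at this
  simp only [Multiset.bind_singleton]
  simpa only [grossmanLarson, mul_comm, mul_assoc, mul_left_comm] using this

/-! ### Multiplicativity of the coproduct on series -/

/-- Compatibility of a product of words with the coproduct and the unit. -/
structure CoshuffleCompatible (op : Forest → Forest → Multiset Forest) : Prop where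
  graded : Graded op
  nil_right : ∀ μ, op μ [] = {μ}
  coshuffle_op : ∀ μ ν, ((op μ ν).bind coshuffle) =
    (coshuffle μ).bind fun p => (coshuffle ν).bind fun q => op p.1 q.1 ×ˢ op p.2 q.2

theorem bind_singleton_self {β : Type*} (s : Multiset β) : (s.bind fun b => {b}) = s :=
  (Multiset.bind_singleton s id).trans (Multiset.map_id s)

theorem compatible_concat : CoshuffleCompatible fun μ ν => {μ ++ ν} where
  graded := graded_concat
  nil_right μ := by simp
  coshuffle_op μ ν := by
    have := coshuffle_append μ ν fun a b => {(a, b)}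
    simpa [Multiset.bind_singleton, bind_singleton_self] using this

theorem compatible_grossmanLarson : CoshuffleCompatible grossmanLarson where
  graded := graded_grossmanLarson
  nil_right := grossmanLarson_nil_right
  coshuffle_op μ ν := by
    have := coshuffle_grossmanLarson μ ν fun a b => {(a, b)}
    simp only [Multiset.bind_singleton, Prod.mk.eta, bind_singleton_self] at this
    exact this

theorem count_product {α β : Type*} [DecidableEq α] [DecidableEq β] (s : Multiset α)
    (t : Multiset β) (a : α) (b : β) : (s ×ˢ t).count (a, b) = s.count a * t.count b := by
  induction s using Multiset.induction with
  | empty => simp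
  | cons x s ih =>
    rw [Multiset.cons_product, Multiset.count_add, ih, Multiset.count_cons]
    by_cases h : a = x
    · subst h
      rw [Multiset.count_map_eq_count' _ _ (Prod.mk_right_injective a)]
      simp; ring
    · rw [Multiset.count_eq_zero_of_notMem]
      · simp [h]
      · simp [Ne.symm h]

/-- This is `Δ(α β) = Δ(α) (β ⊗ 1 + 1 ⊗ β)`. The unit occurs only as a right factor, which is why
`nil_right` is the only unit law required of the product. -/
theorem coproduct_extend {op : Forest → Forest → Multiset Forest} (hop : CoshuffleCompatible op)
    (α : LBSeries k) {β : LBSeries k} (hβ : β ∈ infChars k) (μ ν : Forest) :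
    coproduct (extend op α β) (μ, ν) = extend op (fun a => coproduct α (a, ν)) β μ +
      extend op (fun b => coproduct α (μ, b)) β ν := by
  set N := nodes μ + nodes ν with hN
  have hμ : nodes μ ≤ N := by omega
  have hν : nodes ν ≤ N := by omega
  have h0 : ([] : Forest) ∈ wordsLE N := mem_wordsLE.2 (by simp [nodes])
  rw [coproduct_eq_sum _ (N := N) le_rfl, sum_extend_mul_count hop.graded _ _ coshuffle (μ, ν)
    fun σ hσ => (nodes_coshuffle hσ).ge, extend_eq_sum hop.graded _ _ hμ,
    extend_eq_sum hop.graded _ _ hν]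
  simp only [hop.coshuffle_op]
  have h1 : ∀ ρ, ∑ σ ∈ wordsLE N, α σ * (((coshuffle σ).bind fun p =>
      (coshuffle ρ).bind fun q => op p.1 q.1 ×ˢ op p.2 q.2).count (μ, ν) : k) = _ := fun ρ =>
    sum_coproduct_mul_count α (fun p => (coshuffle ρ).bind fun q => op p.1 q.1 ×ˢ op p.2 q.2)
      (μ, ν) fun p hp => by
        obtain ⟨q, hq, h⟩ := Multiset.mem_bind.1 hp
        rw [Multiset.mem_product] at h
        have := hop.graded _ _ _ h.1
        have := hop.graded _ _ _ h.2
        simp only at *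
        omega
  have h2 : ∀ p : Forest × Forest, ∑ ρ ∈ wordsLE N, β ρ * (((coshuffle ρ).bind fun q =>
      op p.1 q.1 ×ˢ op p.2 q.2).count (μ, ν) : k) = _ := fun p =>
    sum_coproduct_mul_count β (fun q => op p.1 q.1 ×ˢ op p.2 q.2)
      (μ, ν) fun q h => by
        rw [Multiset.mem_product] at h
        have := hop.graded _ _ _ h.1
        have := hop.graded _ _ _ h.2
        simp only at *
        omega
  -- The same coefficient in terms of `Δ α` and `Δ β`, multiplied factor by factor.
  have h3 : ∑ σ ∈ wordsLE N, ∑ ρ ∈ wordsLE N, α σ * β ρ * (((coshuffle σ).bind fun p =>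
      (coshuffle ρ).bind fun q => op p.1 q.1 ×ˢ op p.2 q.2).count (μ, ν) : k) =
      ∑ a ∈ wordsLE N, ∑ b ∈ wordsLE N, coproduct α (a, b) * ∑ c ∈ wordsLE N, ∑ d ∈ wordsLE N,
        coproduct β (c, d) * ((op a c ×ˢ op b d).count (μ, ν) : k) := by
    simp only [← h2 (_, _), Finset.mul_sum]
    rw [Finset.sum_comm]
    conv_rhs => rw [Finset.sum_congr rfl fun a _ => Finset.sum_comm, Finset.sum_comm]
    refine Finset.sum_congr rfl fun ρ _ => ?_
    have := congrArg (β ρ * ·) (h1 ρ)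
    simp only [Finset.mul_sum] at this
    simpa only [mul_comm, mul_assoc, mul_left_comm] using this
  rw [h3]
  have h4 : ∀ c d, coproduct β (c, d) = one c * β d + β c * one d := hβ
  simp only [h4, count_product, Nat.cast_mul, one, Pi.single_apply, add_mul, ite_mul, mul_ite,
    one_mul, mul_one, zero_mul, mul_zero, Finset.sum_add_distrib, Finset.sum_ite_eq',
    Finset.sum_ite_irrel, Finset.sum_const_zero, h0, if_true, hop.nil_right,
    Multiset.count_singleton, mul_add]
  have hμN : μ ∈ wordsLE N := mem_wordsLE.2 hμ
  have hνN : ν ∈ wordsLE N := mem_wordsLE.2 hν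
  rw [add_comm]
  simp only [Nat.cast_ite, Nat.cast_one, Nat.cast_zero, ite_mul, mul_ite, one_mul, mul_one,
    zero_mul, mul_zero, Finset.sum_ite_irrel, Finset.sum_const_zero, Finset.sum_ite_eq, hμN, hνN,
    if_true, Finset.mul_sum, mul_assoc]

end
-- For Cauchy products of truncated series: terms of total degree above `N` vanish, so the triangle
-- may be completed to a square.
theorem sum_range_sum_antidiagonal {M : Type*} [AddCommMonoid M] (N : ℕ) (f : ℕ → ℕ → M)
    (h : ∀ i j, N < i + j → f i j = 0) :
    ∑ n ∈ Finset.range (N + 1), ∑ p ∈ Finset.HasAntidiagonal.antidiagonal n, f p.1 p.2 =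
      ∑ i ∈ Finset.range (N + 1), ∑ j ∈ Finset.range (N + 1), f i j := by
  rw [← Finset.sum_product', Finset.sum_sigma']
  rw [← Finset.sum_filter_of_ne (p := fun p : ℕ × ℕ => p.1 + p.2 ≤ N) (fun p _ hp => by
    by_contra h1
    exact hp (h _ _ (not_le.1 h1)))]
  refine Finset.sum_nbij' (fun x => x.2) (fun p => ⟨p.1 + p.2, p⟩) ?_ ?_ ?_ ?_ ?_
  · rintro ⟨n, p⟩ hp
    simp only [Finset.mem_sigma, Finset.mem_range, Finset.HasAntidiagonal.mem_antidiagonal] at hp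
    simp only [Finset.mem_filter, Finset.mem_product, Finset.mem_range]
    omega
  · rintro p hp
    simp only [Finset.mem_filter, Finset.mem_product, Finset.mem_range] at hp
    simp only [Finset.mem_sigma, Finset.mem_range, Finset.HasAntidiagonal.mem_antidiagonal, and_true]
    omega
  · rintro ⟨n, p⟩ hp
    simp only [Finset.mem_sigma, Finset.HasAntidiagonal.mem_antidiagonal] at hp
    obtain ⟨_, rfl⟩ := hp
    rfl
  · intros; rfl
  · intros; rfl

/-! ### Exponentials of infinitesimal characters -/

section

variable {k : Type*} [Field k]

theorem power_eq_zero {op : Forest → Forest → Multiset Forest} (hop : Graded op)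
    {α : LBSeries k} (hα : α [] = 0) {n : ℕ} {ω : Forest} (hω : nodes ω < n) :
    power (extend op) α n ω = 0 :=
  power_extend_eq_zero hop hα n ω hω

theorem expSeries_eq_sum {op : Forest → Forest → Multiset Forest} (hop : Graded op)
    {α : LBSeries k} (hα : α [] = 0) {ω : Forest} {N : ℕ} (h : nodes ω ≤ N) :
    expSeries (extend op) α ω =
      ∑ n ∈ Finset.range (N + 1), (n ! : k)⁻¹ * power (extend op) α n ω := by
  refine finsum_eq_sum_of_support_subset _ fun n hn => ?_
  rw [Finset.mem_coe, Finset.mem_range]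
  by_contra h1
  exact hn (by simp only; rw [power_eq_zero hop hα (by omega), mul_zero])

theorem expSeries_nil {op : Forest → Forest → Multiset Forest} (hop : Graded op)
    {α : LBSeries k} (hα : α [] = 0) : expSeries (extend op) α [] = 1 := by
  rw [expSeries_eq_sum hop hα (N := 0) (by simp [nodes])]
  simp [power, one]

theorem exp_eq_sum {α : LBSeries k} (hα : α [] = 0) {ω : Forest} {N : ℕ} (h : nodes ω ≤ N) :
    exp α ω = ∑ n ∈ Finset.range (N + 1), (n ! : k)⁻¹ * power concatMul α n ω :=
  expSeries_eq_sum graded_concat hα h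

theorem exp_nil {α : LBSeries k} (hα : α [] = 0) : exp α [] = 1 :=
  expSeries_nil graded_concat hα

theorem coproduct_one (μ ν : Forest) : coproduct (one : LBSeries k) (μ, ν) = one μ * one ν := by
  have h0 : ([] : Forest) ∈ wordsLE (nodes μ + nodes ν) := mem_wordsLE.2 (by simp [nodes])
  rw [coproduct_eq_sum _ (N := nodes μ + nodes ν) le_rfl]
  simp only [one, Pi.single_apply, ite_mul, one_mul, zero_mul, Finset.sum_ite_eq', h0, if_true,
    coshuffle, Multiset.count_singleton, Prod.mk.injEq]
  by_cases h1 : μ = [] <;> by_cases h2 : ν = [] <;> simp [h1, h2]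

/-- The binomial theorem for `(α ⊗ 1 + 1 ⊗ α)ⁿ`; the induction step is `coproduct_extend` followed
by Pascal's rule. -/
theorem coproduct_power {op : Forest → Forest → Multiset Forest} (hop : CoshuffleCompatible op)
    {α : LBSeries k} (hα : α ∈ infChars k) (n : ℕ) (μ ν : Forest) :
    coproduct (power (extend op) α n) (μ, ν) = ∑ p ∈ Finset.HasAntidiagonal.antidiagonal n,
      (n.choose p.1 : k) * (power (extend op) α p.1 μ * power (extend op) α p.2 ν) := by
  induction n generalizing μ ν with
  | zero => simp [power, coproduct_one]
  | succ n ih =>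
    rw [power, coproduct_extend hop _ hα]
    have h1 : (fun a => coproduct (power (extend op) α n) (a, ν)) =
        ∑ p ∈ Finset.HasAntidiagonal.antidiagonal n,
          ((n.choose p.1 : k) * power (extend op) α p.2 ν) • power (extend op) α p.1 := by
      ext a
      simp only [ih, Finset.sum_apply, Pi.smul_apply, smul_eq_mul]
      exact Finset.sum_congr rfl fun p _ => by ring
    have h2 : (fun b => coproduct (power (extend op) α n) (μ, b)) =
        ∑ p ∈ Finset.HasAntidiagonal.antidiagonal n,
          ((n.choose p.1 : k) * power (extend op) α p.1 μ) • power (extend op) α p.2 := by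
      ext a
      simp only [ih, Finset.sum_apply, Pi.smul_apply, smul_eq_mul]
      exact Finset.sum_congr rfl fun p _ => by ring
    rw [h1, h2, ← extendLin_apply hop.graded, ← extendLin_apply hop.graded]
    simp only [map_sum, LinearMap.sum_apply, map_smul, LinearMap.smul_apply, extendLin_apply,
      Finset.sum_apply, Pi.smul_apply, smul_eq_mul]
    rw [Finset.sum_antidiagonal_choose_succ_mul (fun i j =>
      power (extend op) α i μ * power (extend op) α j ν), add_comm]
    simp only [power]
    congr 1
    · exact Finset.sum_congr rfl fun p _ => by ring
    · refine Finset.sum_congr rfl fun p hp => ?_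
      rw [Nat.choose_symm_of_eq_add (Finset.HasAntidiagonal.mem_antidiagonal.1 hp).symm]
      ring

variable [CharZero k]

/-- Dividing `coproduct_power` by `n!` turns the binomial coefficient into `1 / (i! j!)`, so the sum
over `n` is the product of two exponential series. -/
theorem expSeries_mem_chars {op : Forest → Forest → Multiset Forest}
    (hop : CoshuffleCompatible op) {α : LBSeries k} (hα : α ∈ infChars k) :
    expSeries (extend op) α ∈ chars k := by
  have h0 := infChars_nil hα
  refine ⟨fun μ ν => ?_, expSeries_nil hop.graded h0⟩
  set N := nodes μ + nodes ν with hN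
  rw [expSeries_eq_sum hop.graded h0 (show nodes μ ≤ N by omega),
    expSeries_eq_sum hop.graded h0 (show nodes ν ≤ N by omega), Finset.sum_mul_sum,
    ← sum_range_sum_antidiagonal N fun i j => ((i ! : k)⁻¹ * power (extend op) α i μ) *
      ((j ! : k)⁻¹ * power (extend op) α j ν)]
  · have h1 : coproduct (expSeries (extend op) α) (μ, ν) =
        coproduct (∑ n ∈ Finset.range (N + 1), (n ! : k)⁻¹ • power (extend op) α n) (μ, ν) :=
      coproduct_congr fun ω hω => by
        rw [expSeries_eq_sum hop.graded h0 hω.le, Finset.sum_apply]; rfl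
    rw [h1, ← coproductLin_apply]
    simp only [map_sum, map_smul, coproductLin_apply, Finset.sum_apply, Pi.smul_apply, smul_eq_mul,
      coproduct_power hop hα, Finset.mul_sum]
    refine Finset.sum_congr rfl fun n _ => Finset.sum_congr rfl fun p hp => ?_
    rw [← Finset.HasAntidiagonal.mem_antidiagonal.1 hp, Nat.cast_add_choose]
    have h1 : ((p.1 + p.2)! : k) ≠ 0 := Nat.cast_ne_zero.2 (Nat.factorial_ne_zero _)
    have h2 : (p.1 ! : k) ≠ 0 := Nat.cast_ne_zero.2 (Nat.factorial_ne_zero _)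
    have h3 : (p.2 ! : k) ≠ 0 := Nat.cast_ne_zero.2 (Nat.factorial_ne_zero _)
    field_simp
  · intro i j hij
    by_cases hi : nodes μ < i
    · simp [power_eq_zero hop.graded h0 hi]
    · simp [power_eq_zero hop.graded h0 (show nodes ν < j by omega)]

theorem expStar_mem_chars {α : LBSeries k} (hα : α ∈ infChars k) : expStar α ∈ chars k :=
  expSeries_mem_chars compatible_grossmanLarson hα

theorem exp_mem_chars {α : LBSeries k} (hα : α ∈ infChars k) : exp α ∈ chars k :=
  expSeries_mem_chars compatible_concat hα

end

/-! ### Power series in `ad_θ` and the inverse of `dexp` -/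

section

variable {k : Type*} [Field k]

variable (k) in
/-- The infinitesimal characters, as a subspace. -/
def infCharsSubmodule : Submodule k (LBSeries k) where
  carrier := infChars k
  zero_mem' μ ν := by
    rw [← coproductLin_apply, map_zero]; simp
  add_mem' := fun {α β} hα hβ μ ν => by
    have h := congrFun (map_add coproductLin α β) (μ, ν)
    simp only [coproductLin_apply, Pi.add_apply] at h
    rw [h, hα μ ν, hβ μ ν]
    simp only [Pi.add_apply]
    ring
  smul_mem' c α hα μ ν := by
    have h := congrFun (map_smul coproductLin c α) (μ, ν)
    simp only [coproductLin_apply, Pi.smul_apply] at h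
    rw [h, hα μ ν]
    simp only [Pi.smul_apply, smul_eq_mul]
    ring

/-- Primitivity at `(μ, ν)` sees only words with at most `nodes μ + nodes ν` nodes. This makes the
infinitesimal characters closed under infinite sums that are finite in each degree. -/
theorem mem_infChars_of_eqOn {α : LBSeries k}
    (h : ∀ N, ∃ β ∈ infChars k, ∀ ω, nodes ω ≤ N → α ω = β ω) : α ∈ infChars k := by
  intro μ ν
  obtain ⟨β, hβ, h1⟩ := h (nodes μ + nodes ν)
  rw [coproduct_congr fun ω hω => h1 ω hω.le, hβ, h1 μ (by omega), h1 ν (by omega)]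

/-- Concatenation of series, as a bilinear map. -/
noncomputable def concatLin : LBSeries k →ₗ[k] LBSeries k →ₗ[k] LBSeries k :=
  extendLin graded_concat

@[simp] theorem concatLin_apply (α β : LBSeries k) : concatLin α β = concatMul α β := rfl

theorem concatMul_congr {α β α' β' : LBSeries k} {N : ℕ} {ω : Forest} (hω : nodes ω ≤ N)
    (h : ∀ μ, nodes μ ≤ N → α μ = α' μ) (h' : ∀ μ, nodes μ ≤ N → β μ = β' μ) :
    concatMul α β ω = concatMul α' β' ω :=
  extend_congr graded_concat fun μ ν h1 => by rw [h μ (by omega), h' ν (by omega)]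

theorem bracket_mem_infChars {α β : LBSeries k} (hα : α ∈ infChars k) (hβ : β ∈ infChars k) :
    bracket α β ∈ infChars k := by
  -- The mixed terms `α ⊗ β + β ⊗ α` are symmetric in `α` and `β`, so they cancel in the commutator.
  have key : ∀ {α β : LBSeries k}, α ∈ infChars k → β ∈ infChars k → ∀ μ ν,
      coproduct (concatMul α β) (μ, ν) = one μ * concatMul α β ν + concatMul α β μ * one ν +
        (α μ * β ν + α ν * β μ) := by
    intro α β hα hβ μ ν
    rw [concatMul, coproduct_extend compatible_concat _ hβ]
    have h1 : (fun a => coproduct α (a, ν)) = α ν • one + (one ν : k) • α := by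
      ext a
      simp only [hα a ν, Pi.add_apply, Pi.smul_apply, smul_eq_mul]
      ring
    have h2 : (fun b => coproduct α (μ, b)) = α μ • one + (one μ : k) • α := by
      ext b
      simp only [hα μ b, Pi.add_apply, Pi.smul_apply, smul_eq_mul]
      ring
    rw [h1, h2, ← extendLin_apply graded_concat, ← extendLin_apply graded_concat]
    simp only [map_add, map_smul, LinearMap.add_apply, LinearMap.smul_apply, Pi.add_apply,
      Pi.smul_apply, smul_eq_mul, extendLin_apply]
    rw [show extend (fun μ ν => {μ ++ ν}) one β = β from one_concatMul β]
    ring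
  intro μ ν
  have h := congrFun (map_sub coproductLin (concatMul α β) (concatMul β α)) (μ, ν)
  simp only [coproductLin_apply, Pi.sub_apply] at h
  rw [bracket, h, key hα hβ, key hβ hα]
  simp only [Pi.sub_apply]
  ring

/-- `ad_θ` as a linear map. -/
noncomputable def adLin (θ : LBSeries k) : Module.End k (LBSeries k) :=
  concatLin θ - concatLin.flip θ

theorem adLin_pow_apply (θ η : LBSeries k) (n : ℕ) : (adLin θ ^ n) η = (bracket θ)^[n] η := by
  rw [Module.End.pow_apply]; rfl

theorem iterate_bracket_mem_infChars {θ η : LBSeries k} (hθ : θ ∈ infChars k)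
    (hη : η ∈ infChars k) (n : ℕ) : (bracket θ)^[n] η ∈ infChars k := by
  induction n with
  | zero => exact hη
  | succ n ih => rw [Function.iterate_succ_apply']; exact bracket_mem_infChars hθ ih

theorem iterate_bracket_congr (θ : LBSeries k) {η η' : LBSeries k} {N : ℕ}
    (h : ∀ ω, nodes ω ≤ N → η ω = η' ω) (n : ℕ) (ω : Forest) (hω : nodes ω ≤ N) :
    (bracket θ)^[n] η ω = (bracket θ)^[n] η' ω := by
  induction n generalizing ω with
  | zero => exact h ω hω
  | succ n ih =>
    rw [Function.iterate_succ_apply', Function.iterate_succ_apply', bracket, bracket, Pi.sub_apply,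
      Pi.sub_apply, concatMul_congr hω (fun _ _ => rfl) ih, concatMul_congr hω ih fun _ _ => rfl]

/-- A power series in `ad_θ`, applied to `η`. -/
noncomputable def adSeries (p : PowerSeries k) (θ η : LBSeries k) : LBSeries k :=
  fun ω => ∑ᶠ n : ℕ, p.coeff n * (bracket θ)^[n] η ω

theorem adSeries_eq_sum (p : PowerSeries k) {θ : LBSeries k} (hθ : θ [] = 0) (η : LBSeries k)
    {ω : Forest} {N : ℕ} (h : nodes ω ≤ N) :
    adSeries p θ η ω = ∑ n ∈ Finset.range (N + 1), p.coeff n * (bracket θ)^[n] η ω := by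
  refine finsum_eq_sum_of_support_subset _ fun n hn => ?_
  rw [Finset.mem_coe, Finset.mem_range]
  by_contra h1
  exact hn (by simp only; rw [iterate_bracket_eq_zero hθ _ _ _ (by omega), mul_zero])

theorem adSeries_eq_sum_smul (p : PowerSeries k) {θ : LBSeries k} (hθ : θ [] = 0) (η : LBSeries k)
    {ω : Forest} {N : ℕ} (h : nodes ω ≤ N) :
    adSeries p θ η ω = (∑ n ∈ Finset.range (N + 1), p.coeff n • (bracket θ)^[n] η) ω := by
  rw [adSeries_eq_sum p hθ η h, Finset.sum_apply]; rfl

theorem adSeries_one {θ : LBSeries k} (hθ : θ [] = 0) (η : LBSeries k) :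
    adSeries 1 θ η = η := by
  ext ω
  rw [adSeries_eq_sum 1 hθ η le_rfl, Finset.sum_range_succ']
  simp [PowerSeries.coeff_one]

/-- Powers of `ad_θ` add under composition, and since `θ` has no constant term all sums are finite
in each degree. Inverting `dexp` thus becomes inverting a power series. -/
theorem adSeries_mul (p q : PowerSeries k) {θ : LBSeries k} (hθ : θ [] = 0) (η : LBSeries k) :
    adSeries (p * q) θ η = adSeries p θ (adSeries q θ η) := by
  ext ω
  rw [adSeries_eq_sum _ hθ _ le_rfl, adSeries_eq_sum _ hθ _ le_rfl]
  have h1 : ∀ n, (bracket θ)^[n] (adSeries q θ η) ω = ∑ m ∈ Finset.range (nodes ω + 1),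
      q.coeff m * (bracket θ)^[n + m] η ω := by
    intro n
    rw [iterate_bracket_congr θ
      (η' := ∑ m ∈ Finset.range (nodes ω + 1), q.coeff m • (bracket θ)^[m] η) (fun σ hσ => adSeries_eq_sum_smul q hθ η hσ) n ω le_rfl,
      ← adLin_pow_apply]
    simp only [map_sum, map_smul, Finset.sum_apply, Pi.smul_apply, smul_eq_mul]
    simp only [← adLin_pow_apply, pow_add, Module.End.mul_apply]
  simp only [h1, Finset.mul_sum, PowerSeries.coeff_mul, Finset.sum_mul]
  rw [← sum_range_sum_antidiagonal (nodes ω) fun n m =>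
    p.coeff n * (q.coeff m * (bracket θ)^[n + m] η ω)]
  · refine Finset.sum_congr rfl fun n _ => Finset.sum_congr rfl fun x hx => ?_
    rw [Finset.HasAntidiagonal.mem_antidiagonal.1 hx, mul_assoc]
  · intro i j hij
    rw [iterate_bracket_eq_zero hθ _ _ _ hij, mul_zero, mul_zero]

variable [CharZero k]

theorem adSeries_mem_infChars (p : PowerSeries k) {θ η : LBSeries k} (hθ : θ ∈ infChars k)
    (hη : η ∈ infChars k) : adSeries p θ η ∈ infChars k :=
  mem_infChars_of_eqOn fun N => ⟨∑ n ∈ Finset.range (N + 1), p.coeff n • (bracket θ)^[n] η,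
    (infCharsSubmodule k).sum_mem fun n _ =>
      (infCharsSubmodule k).smul_mem _ (iterate_bracket_mem_infChars hθ hη n),
    fun _ hω => adSeries_eq_sum_smul p (infChars_nil hθ) η hω⟩

theorem dexpInv_eq_adSeries (θ η : LBSeries k) :
    dexpInv θ η = adSeries (bernoulli'PowerSeries k) θ η := by
  ext ω
  simp [dexpInv, adSeries, bernoulli'PowerSeries]

variable (k) in
/-- The power series `(1 - e⁻ᶻ) / z`. -/
noncomputable def dexpPowerSeries : PowerSeries k :=
  PowerSeries.mk fun n => (-1) ^ n * ((n + 1)! : k)⁻¹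

theorem X_mul_dexpPowerSeries :
    PowerSeries.X * dexpPowerSeries k = 1 - PowerSeries.evalNegHom (PowerSeries.exp k) := by
  ext n
  cases n with
  | zero =>
    rw [PowerSeries.coeff_zero_X_mul, map_sub, PowerSeries.evalNegHom, PowerSeries.coeff_rescale]
    simp
  | succ n =>
    rw [PowerSeries.coeff_succ_X_mul]
    simp [dexpPowerSeries, PowerSeries.evalNegHom, PowerSeries.coeff_rescale, PowerSeries.coeff_one,
      pow_succ]

/-- Multiply `B(z) (e^z - 1) = z e^z` by `e⁻ᶻ` and cancel `z`. -/
theorem bernoulli'PowerSeries_mul_dexpPowerSeries :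
    bernoulli'PowerSeries k * dexpPowerSeries k = 1 := by
  have h := congrArg (· * PowerSeries.evalNegHom (PowerSeries.exp k))
    (bernoulli'PowerSeries_mul_exp_sub_one k)
  simp only [mul_assoc, sub_mul, PowerSeries.exp_mul_exp_neg_eq_one, one_mul, mul_one] at h
  rw [← X_mul_dexpPowerSeries] at h
  refine mul_left_cancel₀ (PowerSeries.X_ne_zero) (b := _) ?_
  rw [mul_one, mul_left_comm]
  exact h

/-- The left trivialized differential of the exponential,
`dexp_θ(η) = ∑ (-1)ⁿ / (n+1)! ad_θⁿ(η)`. -/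
noncomputable def dexp (θ η : LBSeries k) : LBSeries k := adSeries (dexpPowerSeries k) θ η

theorem dexp_dexpInv {θ : LBSeries k} (hθ : θ [] = 0) (η : LBSeries k) :
    dexp θ (dexpInv θ η) = η := by
  rw [dexpInv_eq_adSeries, dexp, ← adSeries_mul _ _ hθ, mul_comm,
    bernoulli'PowerSeries_mul_dexpPowerSeries, adSeries_one hθ]

theorem dexpInv_dexp {θ : LBSeries k} (hθ : θ [] = 0) (η : LBSeries k) :
    dexpInv θ (dexp θ η) = η := by
  rw [dexpInv_eq_adSeries, dexp, ← adSeries_mul _ _ hθ,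
    bernoulli'PowerSeries_mul_dexpPowerSeries, adSeries_one hθ]

theorem bijOn_dexpInv {θ : LBSeries k} (hθ : θ ∈ infChars k) :
    Set.BijOn (dexpInv θ) (infChars k) (infChars k) :=
  Set.InvOn.bijOn (f' := dexp θ)
    ⟨fun η _ => dexp_dexpInv (infChars_nil hθ) η, fun η _ => dexpInv_dexp (infChars_nil hθ) η⟩
    (fun η hη => by rw [dexpInv_eq_adSeries]; exact adSeries_mem_infChars _ hθ hη)
    (fun η hη => adSeries_mem_infChars _ hθ hη)

end
-- Differentiation of curves of series
/-- A notion of derivative for functions of a time parameter. -/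
structure TimeDerivative (k T : Type*) [Field k] where
  /-- The function `f` has derivative `v` at time `t`. -/
  HasD : (T → k) → k → T → Prop
  const : ∀ c t, HasD (fun _ => c) 0 t
  add : ∀ {f g a b t}, HasD f a t → HasD g b t → HasD (fun s => f s + g s) (a + b) t
  mul : ∀ {f g a b t}, HasD f a t → HasD g b t →
    HasD (fun s => f s * g s) (a * g t + f t * b) t
  -- The only property beyond the sum and product rules; it is what makes initial value problems
  -- uniquely solvable.
  eq_of_zero : ∀ {f}, (∀ t, HasD f 0 t) → ∀ s t, f s = f t

section

variable {k : Type*} [Field k]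

/-- The derivative of `θⁿ` in the direction `v`. -/
noncomputable def powerDeriv (θ v : LBSeries k) : ℕ → LBSeries k
  | 0 => 0
  | n + 1 => concatMul (powerDeriv θ v n) θ + concatMul (power concatMul θ n) v

/-- With `w = ad_θ^j(v)` one has `w θ = θ w - ad_θ(w)`. Moving the factors `θ` to the left by this
rule produces the binomial coefficients through Pascal's rule. -/
theorem powerDeriv_succ (θ v : LBSeries k) (m : ℕ) :
    powerDeriv θ v (m + 1) = ∑ p ∈ Finset.HasAntidiagonal.antidiagonal m,
      (((m + 1).choose (p.2 + 1) : k) * (-1) ^ p.2) •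
        concatMul (power concatMul θ p.1) ((bracket θ)^[p.2] v) := by
  induction m with
  | zero =>
    have h : concatMul (0 : LBSeries k) θ = 0 := by rw [← concatLin_apply]; simp
    simp [powerDeriv, power, h]
  | succ m ih =>
    rw [powerDeriv, ih, ← concatLin_apply]
    simp only [map_sum, map_smul, LinearMap.sum_apply, LinearMap.smul_apply, concatLin_apply]
    have h1 : ∀ i j, concatMul (concatMul (power concatMul θ i) ((bracket θ)^[j] v)) θ =
        concatMul (power concatMul θ (i + 1)) ((bracket θ)^[j] v) -
          concatMul (power concatMul θ i) ((bracket θ)^[j + 1] v) := by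
      intro i j
      rw [Function.iterate_succ_apply', bracket, ← concatLin_apply (power concatMul θ i) (_ - _),
        map_sub, concatLin_apply, concatLin_apply, power, concatMul_assoc, concatMul_assoc]
      abel
    have h2 : ∀ p ∈ Finset.HasAntidiagonal.antidiagonal (m + 1),
        (((m + 1 + 1).choose (p.2 + 1) : k) * (-1) ^ p.2) •
          concatMul (power concatMul θ p.1) ((bracket θ)^[p.2] v) =
        (((m + 1).choose p.2 : k) * (-1) ^ p.2) •
          concatMul (power concatMul θ p.1) ((bracket θ)^[p.2] v) +
        (((m + 1).choose (p.2 + 1) : k) * (-1) ^ p.2) •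
          concatMul (power concatMul θ p.1) ((bracket θ)^[p.2] v) := fun p _ => by
      rw [Nat.choose_succ_succ, Nat.cast_add, add_mul, add_smul]
    rw [Finset.sum_congr rfl h2, Finset.sum_add_distrib, Finset.Nat.sum_antidiagonal_succ',
      Finset.Nat.sum_antidiagonal_succ]
    simp only [h1, smul_sub, Finset.sum_sub_distrib, Nat.choose_succ_self, Nat.cast_zero, zero_mul,
      zero_smul, Nat.choose_zero_right, Nat.cast_one, pow_zero, one_smul,
      Function.iterate_zero, id_eq, pow_succ, mul_neg, mul_one, neg_smul, Finset.sum_neg_distrib]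
    abel

theorem expSeries_zero {op : Forest → Forest → Multiset Forest} (hop : Graded op) :
    expSeries (extend op) (0 : LBSeries k) = one := by
  ext ω
  rw [expSeries_eq_sum hop rfl le_rfl, Finset.sum_range_succ']
  have h : ∀ α : LBSeries k, extend op α 0 = 0 := fun α => by
    rw [← extendLin_apply hop, map_zero]
  simp [power, h]

variable [CharZero k]

/-- After division by `(i + j + 1)!` the binomial coefficient in `powerDeriv_succ` splits as `1 /
i!` times `1 / (j + 1)!`, which makes the sum a Cauchy product. The range is `N + 2` because
differentiating `θⁿ` can lower the degree by one when `v` has a constant term. -/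
theorem sum_powerDeriv {θ : LBSeries k} (hθ : θ [] = 0) (v : LBSeries k) {ω : Forest} {N : ℕ}
    (h : nodes ω ≤ N) :
    ∑ n ∈ Finset.range (N + 2), (n ! : k)⁻¹ * powerDeriv θ v n ω =
      concatMul (exp θ) (dexp θ v) ω := by
  have h1 : concatMul (exp θ) (dexp θ v) ω =
      concatMul (∑ n ∈ Finset.range (N + 1), (n ! : k)⁻¹ • power concatMul θ n)
        (∑ n ∈ Finset.range (N + 1), (dexpPowerSeries k).coeff n • (bracket θ)^[n] v) ω :=
    concatMul_congr h (fun μ hμ => by rw [exp_eq_sum hθ hμ, Finset.sum_apply]; rfl)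
      fun μ hμ => adSeries_eq_sum_smul _ hθ v hμ
  rw [h1, ← concatLin_apply]
  simp only [map_sum, map_smul, LinearMap.sum_apply, LinearMap.smul_apply, concatLin_apply,
    Finset.sum_apply, Pi.smul_apply, smul_eq_mul, Finset.mul_sum]
  rw [Finset.sum_comm, ← sum_range_sum_antidiagonal N fun i j => (dexpPowerSeries k).coeff j *
    ((i ! : k)⁻¹ * concatMul (power concatMul θ i) ((bracket θ)^[j] v) ω), Finset.sum_range_succ']
  · rw [powerDeriv, Pi.zero_apply, mul_zero, add_zero]
    simp only [powerDeriv_succ, Finset.sum_apply, Pi.smul_apply, smul_eq_mul, Finset.mul_sum]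
    refine Finset.sum_congr rfl fun n _ => Finset.sum_congr rfl fun p hp => ?_
    rw [dexpPowerSeries, PowerSeries.coeff_mk, ← Finset.HasAntidiagonal.mem_antidiagonal.1 hp,
      show p.1 + p.2 + 1 = (p.2 + 1) + p.1 by ring, Nat.cast_add_choose]
    have h1 : ((p.2 + 1 + p.1)! : k) ≠ 0 := Nat.cast_ne_zero.2 (Nat.factorial_ne_zero _)
    have h2 : (p.1 ! : k) ≠ 0 := Nat.cast_ne_zero.2 (Nat.factorial_ne_zero _)
    have h3 : ((p.2 + 1)! : k) ≠ 0 := Nat.cast_ne_zero.2 (Nat.factorial_ne_zero _)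
    field_simp
  · intro i j hij
    have h2 : concatMul (power concatMul θ i) ((bracket θ)^[j] v) ω = 0 :=
      extend_eq_zero nodes_concat (fun μ hμ => power_eq_zero graded_concat hθ hμ)
        (fun μ hμ => iterate_bracket_eq_zero hθ v _ μ hμ) (lt_of_le_of_lt h hij)
    rw [h2, mul_zero, mul_zero]

end

namespace TimeDerivative

section

variable {k T : Type*} [Field k] (D : TimeDerivative k T)

theorem sum {ι : Type*} (A : Finset ι) {f : ι → T → k} {v : ι → k} {t : T}
    (h : ∀ i ∈ A, D.HasD (f i) (v i) t) :
    D.HasD (fun s => ∑ i ∈ A, f i s) (∑ i ∈ A, v i) t := by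
  classical
  induction A using Finset.induction_on with
  | empty => simpa using D.const 0 t
  | insert a A ha ih =>
    simp only [Finset.sum_insert ha]
    exact D.add (h a (Finset.mem_insert_self a A))
      (ih fun i hi => h i (Finset.mem_insert_of_mem hi))

theorem const_mul (c : k) {f : T → k} {v : k} {t : T} (h : D.HasD f v t) :
    D.HasD (fun s => c * f s) (c * v) t := by
  simpa using D.mul (D.const c t) h

theorem mul_const (c : k) {f : T → k} {v : k} {t : T} (h : D.HasD f v t) :
    D.HasD (fun s => f s * c) (v * c) t := by
  simpa using D.mul h (D.const c t)

/-- A curve of series has a derivative if each coefficient has. -/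
def HasDS (γ : T → LBSeries k) (v : LBSeries k) (t : T) : Prop :=
  ∀ ω, D.HasD (fun s => γ s ω) (v ω) t

variable {D}

theorem HasDS.const (α : LBSeries k) (t : T) : D.HasDS (fun _ => α) 0 t := fun ω => D.const (α ω) t

theorem HasDS.sub {γ δ : T → LBSeries k} {v w : LBSeries k} {t : T} (h : D.HasDS γ v t)
    (h' : D.HasDS δ w t) : D.HasDS (fun s => γ s - δ s) (v - w) t := fun ω => by
  simpa [sub_eq_add_neg] using D.add (h ω) (D.const_mul (-1) (h' ω))

theorem HasDS.extend {op : Forest → Forest → Multiset Forest} (hop : Graded op)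
    {γ δ : T → LBSeries k} {v w : LBSeries k} {t : T} (h : D.HasDS γ v t)
    (h' : D.HasDS δ w t) : D.HasDS (fun s => extend op (γ s) (δ s))
      (LieButcher.extend op v (δ t) + LieButcher.extend op (γ t) w) t := by
  intro ω
  simp only [Pi.add_apply, extend_eq_sum hop _ _ le_rfl, ← Finset.sum_add_distrib]
  refine D.sum _ fun μ _ => D.sum _ fun ν _ => ?_
  rw [← add_mul]
  exact D.mul_const _ (D.mul (h μ) (h' ν))

theorem HasDS.power {θ : T → LBSeries k} {v : LBSeries k} {t : T} (h : D.HasDS θ v t) (n : ℕ) :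
    D.HasDS (fun s => power concatMul (θ s) n) (powerDeriv (θ t) v n) t := by
  induction n with
  | zero => exact HasDS.const one t
  | succ n ih => exact HasDS.extend graded_concat ih h

/-- `d/dt exp(θ) = exp(θ) dexp_θ(θ')`. -/
theorem HasDS.exp [CharZero k] {θ : T → LBSeries k} {v : LBSeries k} {t : T}
    (h : D.HasDS θ v t) (h0 : ∀ s, θ s [] = 0) :
    D.HasDS (fun s => exp (θ s)) (concatMul (exp (θ t)) (dexp (θ t) v)) t := by
  intro ω
  rw [← sum_powerDeriv (h0 t) v (Nat.le_succ_of_le le_rfl)]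
  simp only [fun s => exp_eq_sum (h0 s) (show nodes ω ≤ nodes ω + 2 by omega)]
  exact D.sum _ fun n _ => D.const_mul _ (h.power n ω)

/-- The equation `y' = y * f` determines `y` from its initial value. -/
theorem eq_of_hasDS_grossmanLarsonMul {f : LBSeries k} (hf : f [] = 0) {y z : T → LBSeries k}
    (hy : ∀ t, D.HasDS y (grossmanLarsonMul (y t) f) t)
    (hz : ∀ t, D.HasDS z (grossmanLarsonMul (z t) f) t) {t₀ : T} (h0 : y t₀ = z t₀) : y = z := by
  have hd : ∀ t, D.HasDS (fun s => y s - z s) (grossmanLarsonMul (y t - z t) f) t := by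
    intro t
    have := (hy t).sub (hz t)
    rwa [show grossmanLarsonMul (y t) f - grossmanLarsonMul (z t) f =
      grossmanLarsonMul (y t - z t) f by
        have := LinearMap.map_sub₂ (extendLin graded_grossmanLarson) (y t) (z t) f
        exact this.symm] at this
  -- Since `f` has no constant term, the coefficient of `(y - z) * f` at `ω` involves `y - z` only
  -- on words with fewer nodes. By induction it vanishes at all times, so the coefficient of `y - z`
  -- at `ω` is constant.
  have key : ∀ n ω, nodes ω < n → ∀ t, (y t - z t) ω = 0 := by
    intro n
    induction n with
    | zero => intro ω h; omega
    | succ n ih =>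
      intro ω hω t
      have h1 : ∀ t, grossmanLarsonMul (y t - z t) f ω = 0 := fun t =>
        extend_eq_zero graded_grossmanLarson (fun μ hμ => ih μ hμ t)
          (eq_zero_of_nodes_lt_one hf) hω
      rw [D.eq_of_zero (f := fun s => (y s - z s) ω) (fun t => h1 t ▸ hd t ω) t t₀, h0, sub_self]
      rfl
  funext t ω
  exact sub_eq_zero.1 (key _ ω (Nat.lt_succ_self _) t)

theorem power_smul {op : Forest → Forest → Multiset Forest} (hop : Graded op) (c : k)
    (f : LBSeries k) (n : ℕ) : power (LieButcher.extend op) (c • f) n =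
      c ^ n • LieButcher.power (LieButcher.extend op) f n := by
  induction n with
  | zero => simp [LieButcher.power]
  | succ n ih =>
    rw [LieButcher.power, ih, ← extendLin_apply hop, map_smul, map_smul, LinearMap.smul_apply,
      smul_smul, ← pow_succ']
    rfl

theorem hasD_pow {τ : T → k} {t : T} (hτ : D.HasD τ 1 t) (n : ℕ) :
    D.HasD (fun s => τ s ^ (n + 1)) ((n + 1) * τ t ^ n) t := by
  induction n with
  | zero => simpa using hτ
  | succ n ih =>
    have := D.mul ih hτ
    simp only [← pow_succ] at this
    convert this using 1
    push_cast
    ring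

/-- The curve `exp^*(t f)` solves `y' = y * f`. -/
theorem hasDS_expStar [CharZero k] {f : LBSeries k} (hf : f [] = 0) {τ : T → k} {t : T}
    (hτ : D.HasD τ 1 t) :
    D.HasDS (fun s => expStar (τ s • f)) (grossmanLarsonMul (expStar (τ t • f)) f) t := by
  intro ω
  have hs : ∀ s, (τ s • f) [] = 0 := fun s => by simp [hf]
  have h1 : ∀ s, ∀ {μ N}, nodes μ ≤ N → expStar (τ s • f) μ = ∑ n ∈ Finset.range (N + 1),
      (n ! : k)⁻¹ * (τ s ^ n * power grossmanLarsonMul f n μ) := by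
    intro s μ N hN
    rw [expStar, show grossmanLarsonMul = LieButcher.extend grossmanLarson from rfl,
      expSeries_eq_sum graded_grossmanLarson (hs s) hN]
    simp only [power_smul graded_grossmanLarson, Pi.smul_apply, smul_eq_mul]
  have h2 : grossmanLarsonMul (expStar (τ t • f)) f ω = ∑ n ∈ Finset.range (nodes ω + 1),
      (n ! : k)⁻¹ * (τ t ^ n * power grossmanLarsonMul f (n + 1) ω) := by
    have h3 : grossmanLarsonMul (expStar (τ t • f)) f ω = grossmanLarsonMul
        (∑ n ∈ Finset.range (nodes ω + 1), ((n ! : k)⁻¹ * τ t ^ n) • power grossmanLarsonMul f n)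
        f ω :=
      extend_congr graded_grossmanLarson fun μ ν h => by
        rw [h1 t (show nodes μ ≤ nodes ω by omega), Finset.sum_apply]
        simp only [Pi.smul_apply, smul_eq_mul, mul_assoc]
    rw [h3, grossmanLarsonMul, ← extendLin_apply graded_grossmanLarson]
    simp only [map_sum, map_smul, LinearMap.sum_apply, LinearMap.smul_apply, extendLin_apply,
      Finset.sum_apply, Pi.smul_apply, smul_eq_mul, mul_assoc]
    rfl
  rw [h2]
  -- One extra term is kept, so that removing the constant term `n = 0` leaves the range of
  -- summation in `h2`.
  simp only [fun s => h1 s (show nodes ω ≤ nodes ω + 1 by omega)]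
  have h4 : ∀ s, ∑ n ∈ Finset.range (nodes ω + 1 + 1),
      (n ! : k)⁻¹ * (τ s ^ n * power grossmanLarsonMul f n ω) =
      (∑ n ∈ Finset.range (nodes ω + 1),
        ((n + 1)! : k)⁻¹ * (τ s ^ (n + 1) * power grossmanLarsonMul f (n + 1) ω)) + one ω := by
    intro s
    rw [Finset.sum_range_succ']
    simp [LieButcher.power]
  simp only [h4]
  rw [← add_zero (Finset.sum _ _)]
  refine D.add (D.sum _ fun n _ => ?_) (D.const _ t)
  have h5 := D.const_mul ((n + 1)! : k)⁻¹ (D.mul_const (power grossmanLarsonMul f (n + 1) ω)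
    (hasD_pow hτ n))
  convert h5 using 1
  rw [Nat.factorial_succ, Nat.cast_mul, Nat.cast_succ]
  have h6 : ((n : k) + 1) ≠ 0 := Nat.cast_add_one_ne_zero n
  have h7 : (n ! : k) ≠ 0 := Nat.cast_ne_zero.2 (Nat.factorial_ne_zero _)
  field_simp

/-- Along solutions of `θ' = dexp⁻¹_θ(exp(θ) ▷ f)`, `θ = 0` at time `0`, one has
`exp(θ(t)) = exp^*(t f)`. -/
theorem exp_eq_expStar [CharZero k] {f : LBSeries k} (hf : f ∈ infChars k) {τ : T → k}
    (hτ : ∀ t, D.HasD τ 1 t) {t₀ : T} (h0 : τ t₀ = 0) {θ : T → LBSeries k} (hθ0 : θ t₀ = 0)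
    (hθ : ∀ t, θ t ∈ infChars k) (h : ∀ t, D.HasDS θ (exponentField f (θ t)) t) (t : T) :
    exp (θ t) = expStar (τ t • f) := by
  refine congrFun (eq_of_hasDS_grossmanLarsonMul (D := D) (y := fun t => LieButcher.exp (θ t))
    (z := fun t => expStar (τ t • f)) (infChars_nil hf) (fun t => ?_)
    (fun t => hasDS_expStar (infChars_nil hf) (hτ t)) (t₀ := t₀) ?_) t
  -- `dexp_θ` undoes `dexp⁻¹_θ`, leaving `exp(θ) · (exp(θ) ▷ f)`, which is `exp(θ) * f` for
  -- group-like `exp(θ)`.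
  · have := (h t).exp fun s => infChars_nil (hθ s)
    rwa [exponentField, dexp_dexpInv (infChars_nil (hθ t)),
      ← grossmanLarsonMul_of_mem_chars (exp_mem_chars (hθ t))] at this
  · simp only [hθ0, h0, zero_smul]
    exact (expSeries_zero graded_concat).trans (expSeries_zero graded_grossmanLarson).symm

end

/-! ### The two instances: formal and real time -/

/-- The formal derivative of polynomial functions. -/
def formal (k : Type*) [Field k] [CharZero k] : TimeDerivative k k where
  HasD f v t := ∃ p : Polynomial k, (∀ s, f s = p.eval s) ∧ v = (Polynomial.derivative p).eval t
  const c t := ⟨Polynomial.C c, by simp, by simp⟩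
  add := by
    rintro f g a b t ⟨p, hp, rfl⟩ ⟨q, hq, rfl⟩
    exact ⟨p + q, by simp [hp, hq], by simp⟩
  mul := by
    rintro f g a b t ⟨p, hp, rfl⟩ ⟨q, hq, rfl⟩
    exact ⟨p * q, by simp [hp, hq], by simp [hp, hq]⟩
  eq_of_zero := by
    intro f h s t
    obtain ⟨p, hp, -⟩ := h s
    -- Each time may come with its own polynomial, but over an infinite field they all coincide with
    -- `p`.
    have h1 : Polynomial.derivative p = 0 := Polynomial.funext fun t => by
      obtain ⟨q, hq, h2⟩ := h t
      rw [Polynomial.funext fun s => (hp s).symm.trans (hq s), ← h2, Polynomial.eval_zero]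
    rw [hp, hp, Polynomial.eq_C_of_natDegree_eq_zero
      (Polynomial.derivative_eq_zero.1 h1)]
    simp

theorem hasFormalDerivAt_iff {k : Type*} [Field k] [CharZero k] {γ : k → LBSeries k}
    {v : LBSeries k} {t : k} : HasFormalDerivAt γ v t ↔ (formal k).HasDS γ v t := by
  constructor
  · rintro ⟨p, hp, h⟩ ω
    exact ⟨p ω, fun s => hp s ω, h ω⟩
  · intro h
    choose p hp h using h
    exact ⟨p, fun s ω => hp ω s, h⟩

/-- Uniqueness of the derivative is not part of `TimeDerivative`. Here it holds because a polynomial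
over an infinite field is determined by its values. -/
theorem formal_unique {k : Type*} [Field k] [CharZero k] {γ : k → LBSeries k}
    {v w : LBSeries k} {t : k} (hv : (formal k).HasDS γ v t) (hw : (formal k).HasDS γ w t) :
    v = w := by
  ext ω
  obtain ⟨p, hp, h⟩ := hv ω
  obtain ⟨q, hq, h'⟩ := hw ω
  rw [h, h', Polynomial.funext fun s => (hp s).symm.trans (hq s)]

/-- The derivative of functions on an interval. -/
def real (𝕜 : Type*) [RCLike 𝕜] {S : Set ℝ} (hS : Convex ℝ S) : TimeDerivative 𝕜 S where
  -- The function lives on the subtype `S`; the choice of the extension `F` does not matter, as the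
  -- derivative is taken within `S`.
  HasD f v t := ∃ F : ℝ → 𝕜, (∀ s : S, f s = F s) ∧ HasDerivWithinAt F v S t
  const c t := ⟨fun _ => c, by simp, hasDerivWithinAt_const _ _ _⟩
  add := by
    rintro f g a b t ⟨F, hF, h⟩ ⟨G, hG, h'⟩
    exact ⟨F + G, by simp [hF, hG], h.add h'⟩
  mul := by
    rintro f g a b t ⟨F, hF, h⟩ ⟨G, hG, h'⟩
    exact ⟨F * G, by simp [hF, hG], by rw [hF, hG]; exact h.mul h'⟩
  eq_of_zero := by
    intro f h s t
    obtain ⟨F, hF, -⟩ := h s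
    have h1 : ∀ x ∈ S, HasDerivWithinAt F ((fun _ => 0 : ℝ → 𝕜) x) S x := by
      intro x hx
      obtain ⟨G, hG, h2⟩ := h ⟨x, hx⟩
      exact h2.congr (fun y hy => (hF ⟨y, hy⟩).symm.trans (hG ⟨y, hy⟩))
        ((hF ⟨x, hx⟩).symm.trans (hG ⟨x, hx⟩))
    -- The mean value inequality with bound `0`.
    have h2 := hS.norm_image_sub_le_of_norm_hasDerivWithin_le (C := 0) h1 (by simp) t.2 s.2
    rw [zero_mul, norm_le_zero_iff, sub_eq_zero] at h2
    rw [hF, hF, h2]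

end TimeDerivative

/-! ### Cancellation, the logarithm, and solutions in formal time -/

section

variable {k : Type*} [Field k]

/-- As `α` starts with `1`, the lowest-degree part of `α β` is that of `β`. -/
theorem concatMul_left_injective {α : LBSeries k} (hα : α [] = 1) :
    Function.Injective (concatMul α) := by
  have key : ∀ β : LBSeries k, concatMul α β = 0 → β = 0 := by
    intro β h
    have h1 : ∀ n ω, nodes ω < n → β ω = 0 := by
      intro n
      induction n with
      | zero => intro ω h; omega
      | succ n ih =>
        intro ω hω
        rw [← congrFun (one_concatMul β) ω, ← Pi.zero_apply (M := fun _ => k) ω, ← h]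
        refine extend_congr graded_concat fun μ ν hμν => ?_
        rcases μ with _ | ⟨⟨c⟩, μ⟩
        · simp [one, hα]
        · rw [ih ν (by simp only [nodes] at hμν; omega), mul_zero, mul_zero]
    ext ω
    exact h1 _ ω (Nat.lt_succ_self _)
  intro β γ h
  refine sub_eq_zero.1 (key _ ?_)
  rw [← concatLin_apply, map_sub, concatLin_apply, concatLin_apply, h, sub_self]

/-- In each product the other `n` factors contribute at least one node each, so the factor that
differs is evaluated only on words with at most `N` nodes. -/
theorem power_congr {θ θ' : LBSeries k} (h0 : θ [] = 0) {N : ℕ}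
    (h : ∀ ω, nodes ω ≤ N → θ' ω = θ ω) (n : ℕ) {ω : Forest} (hω : nodes ω ≤ N + n) :
    power concatMul θ' (n + 1) ω = power concatMul θ (n + 1) ω := by
  have h0' : θ' [] = 0 := (h [] (by simp [nodes])).trans h0
  induction n generalizing ω with
  | zero => simpa [power, one_concatMul] using h ω hω
  | succ n ih =>
    rw [power, power.eq_2 _ θ]
    refine extend_congr graded_concat fun μ ν hμν => ?_
    by_cases hν : nodes ν < 1
    · rw [eq_zero_of_nodes_lt_one h0 ν hν, eq_zero_of_nodes_lt_one h0' ν hν, mul_zero, mul_zero]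
    · rw [ih (by omega)]
      by_cases hμ : nodes μ < n + 1
      · rw [show power concatMul θ (n + 1) μ = 0 from power_eq_zero graded_concat h0 hμ, zero_mul,
          zero_mul]
      · rw [h ν (by omega)]

/-- The leading part of `exp(θ') - exp(θ)` is that of `θ' - θ`. -/
theorem exp_apply_of_eqOn {θ θ' : LBSeries k} (h0 : θ [] = 0) {N : ℕ}
    (h : ∀ ω, nodes ω ≤ N → θ' ω = θ ω) {ω : Forest} (hω : nodes ω ≤ N + 1) :
    exp θ' ω = exp θ ω + (θ' ω - θ ω) := by
  have h0' : θ' [] = 0 := (h [] (by simp [nodes])).trans h0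
  rw [exp_eq_sum h0 hω, exp_eq_sum h0' hω]
  simp only [Finset.sum_range_succ' _ (N + 1), Finset.sum_range_succ' _ N]
  rw [Finset.sum_congr rfl fun n _ => by
    rw [power_congr h0 h (n + 1) (show nodes ω ≤ N + (n + 1) by omega)]]
  simp [power, one_concatMul]
  ring

/-- Approximations to the logarithm of `α`: the `N`-th one is correct up to degree `N`. -/
noncomputable def approxLog (α : LBSeries k) : ℕ → LBSeries k
  | 0 => 0
  | N + 1 => fun ω =>
      approxLog α N ω + if nodes ω = N + 1 then α ω - exp (approxLog α N) ω else 0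

theorem approxLog_succ_apply (α : LBSeries k) (N : ℕ) (ω : Forest) : approxLog α (N + 1) ω =
    approxLog α N ω + if nodes ω = N + 1 then α ω - exp (approxLog α N) ω else 0 := rfl

/-- The logarithm of a group-like series. -/
noncomputable def log (α : LBSeries k) : LBSeries k := fun ω => approxLog α (nodes ω) ω

theorem approxLog_apply_of_le (α : LBSeries k) {N : ℕ} {ω : Forest} (h : nodes ω ≤ N) :
    approxLog α N ω = log α ω := by
  induction N, h using Nat.le_induction with
  | base => rfl
  | succ N hN ih => rw [approxLog_succ_apply, ih, if_neg (by omega), add_zero]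

theorem log_one : log (one : LBSeries k) = 0 := by
  have h : ∀ N, approxLog (one : LBSeries k) N = 0 := by
    intro N
    induction N with
    | zero => rfl
    | succ N ih =>
      ext ω
      rw [approxLog_succ_apply, ih, show exp (0 : LBSeries k) = one from expSeries_zero graded_concat]
      simp
  ext ω
  rw [log, h]

variable [CharZero k]

/-- In degree `N + 1` the correction has coproduct `α ⊗ α - exp(θ) ⊗ exp(θ)`. If both words are
nonempty, each has at most `N` nodes and the difference vanishes; what is left are the terms with an
empty word, that is, primitivity. -/
theorem add_mem_infChars_of_exp_eq {α θ : LBSeries k} (hα : α ∈ chars k) (hθ : θ ∈ infChars k)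
    {N : ℕ} (h : ∀ ω, nodes ω ≤ N → exp θ ω = α ω) :
    (fun ω => θ ω + if nodes ω = N + 1 then α ω - exp θ ω else 0) ∈ infChars k := by
  intro μ ν
  have hc : ∀ β : LBSeries k, coproduct (θ + β) (μ, ν) = one μ * θ ν + θ μ * one ν +
      coproduct β (μ, ν) := fun β => by
    rw [← hθ, ← coproductLin_apply, map_add]; rfl
  by_cases hN : nodes μ + nodes ν = N + 1
  · have h1 : coproduct (fun ω => θ ω + if nodes ω = N + 1 then α ω - exp θ ω else 0) (μ, ν) =
        coproduct (θ + (α - exp θ)) (μ, ν) :=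
      coproduct_congr fun ω hω => by simp [hω, hN]
    have h2 : coproduct (α - exp θ) (μ, ν) = α μ * α ν - exp θ μ * exp θ ν := by
      rw [← hα.1, ← (exp_mem_chars hθ).1, ← coproductLin_apply, map_sub]; rfl
    rw [h1, hc, h2]
    have he := exp_nil (infChars_nil hθ)
    rcases μ with _ | ⟨⟨c⟩, μ⟩
    · rcases ν with _ | ⟨⟨d⟩, ν⟩
      · simp [nodes] at hN
      · simp only [nodes, zero_add] at hN
        simp [one, nodes, he, hα.2, hN]
    · rcases ν with _ | ⟨⟨d⟩, ν⟩
      · simp only [nodes, add_zero] at hN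
        simp [one, nodes, he, hα.2, hN]
      · simp only [nodes] at hN
        rw [h (node c :: μ) (by simp only [nodes]; omega),
          h (node d :: ν) (by simp only [nodes]; omega)]
        simp [one]
  · rw [coproduct_congr (β := θ) fun ω hω => by
      rw [if_neg (by simp only at hω; omega), add_zero], hθ]
    rcases μ with _ | ⟨⟨c⟩, μ⟩ <;> rcases ν with _ | ⟨⟨d⟩, ν⟩ <;>
      simp_all [one, nodes]

theorem approxLog_spec {α : LBSeries k} (hα : α ∈ chars k) (N : ℕ) :
    approxLog α N ∈ infChars k ∧ ∀ ω, nodes ω ≤ N → exp (approxLog α N) ω = α ω := by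
  induction N with
  | zero =>
    refine ⟨(infCharsSubmodule k).zero_mem, fun ω hω => ?_⟩
    rcases ω with _ | ⟨⟨c⟩, ω⟩
    · rw [exp_nil rfl, hα.2]
    · simp only [nodes] at hω; omega
  | succ N ih =>
    obtain ⟨h1, h2⟩ := ih
    refine ⟨add_mem_infChars_of_exp_eq hα h1 h2, fun ω hω => ?_⟩
    rw [exp_apply_of_eqOn (infChars_nil h1) (N := N) (fun σ hσ => by
      rw [approxLog_succ_apply, if_neg (by omega), add_zero]) hω, approxLog_succ_apply]
    split_ifs with h
    · ring
    · rw [h2 ω (by omega)]; ring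

theorem log_mem_infChars {α : LBSeries k} (hα : α ∈ chars k) : log α ∈ infChars k :=
  mem_infChars_of_eqOn fun N =>
    ⟨approxLog α N, (approxLog_spec hα N).1, fun _ hω => (approxLog_apply_of_le α hω).symm⟩

theorem exp_log {α : LBSeries k} (hα : α ∈ chars k) : exp (log α) = α := by
  ext ω
  have h := approxLog_spec hα (nodes ω)
  rw [exp_apply_of_eqOn (infChars_nil h.1) (fun σ hσ => (approxLog_apply_of_le α hσ).symm)
    (Nat.le_succ _), h.2 ω le_rfl, approxLog_apply_of_le α le_rfl, sub_self, add_zero]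

/-- Each stage of `approxLog` uses only `exp` and subtraction, which preserve differentiability. The
value of the derivative is not needed: it is recovered later from `exp(log(α)) = α`. -/
theorem TimeDerivative.exists_hasDS_log {T : Type*} {D : TimeDerivative k T}
    {α : T → LBSeries k} (hα : ∀ t, α t ∈ chars k) {t : T} {v : LBSeries k}
    (hv : D.HasDS α v t) : ∃ w, D.HasDS (fun s => log (α s)) w t := by
  have key : ∀ N, ∃ w, D.HasDS (fun s => approxLog (α s) N) w t := by
    intro N
    induction N with
    | zero => exact ⟨0, HasDS.const 0 t⟩
    | succ N ih =>
      obtain ⟨w, hw⟩ := ih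
      have he := hw.exp fun s => infChars_nil (approxLog_spec (hα s) N).1
      have hd := hv.sub he
      refine ⟨fun ω => w ω + if nodes ω = N + 1 then
        (v - concatMul (LieButcher.exp (approxLog (α t) N)) (dexp (approxLog (α t) N) w)) ω else 0,
        fun ω => D.add (hw ω) ?_⟩
      split_ifs
      · exact hd ω
      · exact D.const 0 t
  choose w hw using key
  exact ⟨fun ω => w (nodes ω) ω, fun ω => hw (nodes ω) ω⟩

theorem formal_hasD_id (t : k) : (TimeDerivative.formal k).HasD (fun s => s) 1 t :=
  ⟨Polynomial.X, by simp, by simp⟩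

/-- The derivative along `θ + s η` is `exp(θ) dexp_θ(η)`; cancel `exp(θ)` and invert `dexp_θ`. -/
theorem isLeftTrivializedDifferential_iff {θ : LBSeries k} (hθ : θ ∈ infChars k)
    {η : LBSeries k} (hη : η ∈ infChars k) (ζ : LBSeries k) :
    IsLeftTrivializedDifferential θ η ζ ↔ dexpInv θ ζ = η := by
  have h0 := infChars_nil hθ
  have h1 : (TimeDerivative.formal k).HasDS (fun s : k => θ + s • η) η 0 := fun ω => by
    simpa using (TimeDerivative.formal k).add ((TimeDerivative.formal k).const (θ ω) 0)
      ((TimeDerivative.formal k).mul_const (η ω) (formal_hasD_id 0))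
  have h2 := h1.exp fun s => by simp [h0, infChars_nil hη]
  simp only [zero_smul, add_zero] at h2
  rw [IsLeftTrivializedDifferential, TimeDerivative.hasFormalDerivAt_iff]
  constructor
  · intro h
    rw [concatMul_left_injective (exp_nil h0) (TimeDerivative.formal_unique h h2),
      dexpInv_dexp h0]
  · rintro rfl
    rwa [dexp_dexpInv h0] at h2

/-- The solution is `log(exp^*(t f))`, whose coefficients are polynomials in `t`. -/
theorem exists_isFormalSolution {f : LBSeries k} (hf : f ∈ infChars k) :
    ∃ θ : k → LBSeries k, IsFormalSolution f θ := by
  have hα : ∀ t : k, expStar (t • f) ∈ chars k := fun t =>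
    expStar_mem_chars ((infCharsSubmodule k).smul_mem t hf)
  have hd := fun t : k =>
    TimeDerivative.hasDS_expStar (infChars_nil hf) (formal_hasD_id t)
  have hθ := fun t => log_mem_infChars (hα t)
  refine ⟨fun t => log (expStar (t • f)), ?_, fun t => ⟨hθ t, ?_⟩⟩
  · simp only [zero_smul]
    rw [show expStar (0 : LBSeries k) = one from expSeries_zero graded_grossmanLarson, log_one]
  · obtain ⟨w, hw⟩ := TimeDerivative.exists_hasDS_log hα (hd t)
    have he := hw.exp fun s => infChars_nil (hθ s)
    simp only [exp_log (hα _)] at he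
    -- Two expressions for the derivative of `α = exp^*(t f) = exp(θ)`: `α · dexp_θ(θ')` and `α * f
    -- = α · (α ▷ f)`. Cancelling `α` gives `dexp_θ(θ') = α ▷ f`.
    have h1 := TimeDerivative.formal_unique he (hd t)
    rw [grossmanLarsonMul_of_mem_chars (hα t)] at h1
    have h2 := concatMul_left_injective (hα t).2 h1
    rw [TimeDerivative.hasFormalDerivAt_iff, exponentField, exp_log (hα t), ← h2,
      dexpInv_dexp (infChars_nil (hθ t))]
    exact hw

theorem IsFormalSolution.expStar_eq {f : LBSeries k} (hf : f ∈ infChars k) {θ : k → LBSeries k}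
    (h : IsFormalSolution f θ) : expStar f = exp (θ 1) := by
  rw [TimeDerivative.exp_eq_expStar hf formal_hasD_id rfl h.1 (fun t => (h.2 t).1)
    (fun t => TimeDerivative.hasFormalDerivAt_iff.1 (h.2 t).2) 1, one_smul]

end

/-! ### Solutions in real time -/

section

variable {𝕜 : Type*} [RCLike 𝕜]

/-- The formal solution restricted to real times: for polynomials the formal and the usual
derivative agree. -/
theorem exists_isRealTimeSolutionOn {f : LBSeries 𝕜} (hf : f ∈ infChars 𝕜) :
    ∃ θ : ℝ → LBSeries 𝕜, IsRealTimeSolutionOn Set.univ f θ := by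
  obtain ⟨θ, h0, h⟩ := exists_isFormalSolution hf
  refine ⟨fun t => θ (t : 𝕜), by simpa using h0, fun t _ => ⟨(h t).1, fun ω => ?_⟩⟩
  obtain ⟨p, hp, h'⟩ := (h t).2
  simp only [hp, h']
  have h1 : HasDerivAt (fun s : ℝ => (s : 𝕜)) 1 t := by
    simpa using (RCLike.ofRealCLM (K := 𝕜)).hasDerivAt (x := t)
  simpa [Function.comp_def] using
    (((p ω).hasDerivAt (t : 𝕜)).scomp t h1).hasDerivWithinAt (s := Set.univ)

theorem IsRealTimeSolutionOn.expStar_eq {f : LBSeries 𝕜} (hf : f ∈ infChars 𝕜)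
    {θ : ℝ → LBSeries 𝕜} (h : IsRealTimeSolutionOn (Set.Icc 0 1) f θ) :
    expStar f = exp (θ 1) := by
  have h1 := TimeDerivative.exp_eq_expStar
    (D := TimeDerivative.real 𝕜 (convex_Icc (0 : ℝ) 1)) hf (τ := fun s => ((s : ℝ) : 𝕜))
    (fun t => ⟨fun s => (s : 𝕜), fun _ => rfl, by
      simpa using ((RCLike.ofRealCLM (K := 𝕜)).hasDerivAt (x := (t : ℝ))).hasDerivWithinAt⟩)
    (t₀ := ⟨0, by simp⟩) (by simp) (θ := fun s => θ s) h.1 (fun t => (h.2 t t.2).1)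
    (fun t ω => ⟨fun s => θ s ω, fun _ => rfl, (h.2 t t.2).2 ω⟩) ⟨1, by simp⟩
  simpa using h1.symm

end

end LieButcher

theorem mainTheorem6 {k : Type*} [Field k] [CharZero k] {𝕜 : Type*} [RCLike 𝕜] :
    -- the two exponentials map infinitesimal characters to characters
    (Set.MapsTo LieButcher.expStar (LieButcher.infChars k) (LieButcher.chars k) ∧
      Set.MapsTo LieButcher.exp (LieButcher.infChars k) (LieButcher.chars k)) ∧
    -- the Bernoulli series is the inverse of the left trivialized differential of `exp`
    (∀ θ ∈ LieButcher.infChars k,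
      Set.BijOn (LieButcher.dexpInv θ) (LieButcher.infChars k) (LieButcher.infChars k) ∧
      ∀ η ∈ LieButcher.infChars k, ∀ ζ ∈ LieButcher.infChars k,
        LieButcher.IsLeftTrivializedDifferential θ η ζ ↔ LieButcher.dexpInv θ ζ = η) ∧
    -- the relation of the exponentials, for formal differentiation over `k`
    (∀ f ∈ LieButcher.infChars k,
      (∃ θ : k → LieButcher.LBSeries k, LieButcher.IsFormalSolution f θ) ∧
      ∀ θ : k → LieButcher.LBSeries k, LieButcher.IsFormalSolution f θ →
        LieButcher.expStar f = LieButcher.exp (θ 1)) ∧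
    -- the same for usual differentiation in real time, over the real or complex numbers
    (∀ f ∈ LieButcher.infChars 𝕜,
      (∃ θ : ℝ → LieButcher.LBSeries 𝕜, LieButcher.IsRealTimeSolutionOn Set.univ f θ) ∧
      ∀ θ : ℝ → LieButcher.LBSeries 𝕜, LieButcher.IsRealTimeSolutionOn (Set.Icc 0 1) f θ →
        LieButcher.expStar f = LieButcher.exp (θ 1)) :=
  ⟨⟨fun _ => LieButcher.expStar_mem_chars, fun _ => LieButcher.exp_mem_chars⟩,
    fun _ hθ => ⟨LieButcher.bijOn_dexpInv hθ,
      fun _ hη ζ _ => LieButcher.isLeftTrivializedDifferential_iff hθ hη ζ⟩,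
    fun _ hf => ⟨LieButcher.exists_isFormalSolution hf, fun _ h => h.expStar_eq hf⟩,
    fun _ hf => ⟨LieButcher.exists_isRealTimeSolutionOn hf, fun _ h => h.expStar_eq hf⟩⟩
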